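/- All digraphs are finite, without loops and without parallel arcs (two opposite arcs between a pair of vertices are allowed), and a digraph is connected if its underlying undirected graph is connected (in particular it has at least one vertex). For an integer $s\ge 1$, a digraph $H$ is weakly $s$-degenerate if every non-empty subdigraph $H'$ of $H$ contains a vertex $v$ with $\min\{d^+_{H'}(v),d^-_{H'}(v)\}<s$. Let $D$ be a connected digraph, let $m=\max_{v\in V(D)}\max\{d_D^+(v),d_D^-(v)\}$, let $s\ge 1$ be an integer, and let $L$ assign to every vertex $v\in V(D)$ a finite set $L(v)$ of colors with $|L(v)|\ge \frac{m}{s}$. Call $D$ $(L,s)$-colorable if there is a map $\varphi$ on $V(D)$ with $\varphi(v)\in L(v)$ for all $v\in V(D)$ such that for every color $\alpha$ the induced subdigraph $D[\varphi^{-1}(\alpha)]$ is weakly $s$-degenerate. Then $D$ is not $(L,s)$-colorable if and only if the following two conditions are fulfilled: (a) $D$ is a bidirected complete graph with $|D|-1\equiv 0 \pmod s$, where $|D|$ is the number of vertices of $D$; or $D$ is a bidirected cycle of odd length at least $3$ and $s=1$; or $D$ is Eulerian (that is, $d_D^+(v)=d_D^-(v)$ for every vertex $v$) and every vertex of $D$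 has in-degree and out-degree $s$. (b) There is a set $\Gamma$ of colors such that $L(v)=\Gamma$ for all $v\in V(D)$ and $|\Gamma|=\frac{m}{s}$. Here a bidirected graph is a digraph obtained from a simple undirected graph by replacing each edge by two opposite arcs. -/

import Mathlib

namespace Digraph

/-- The underlying simple graph of `D` (an edge for every pair of distinct vertices joined by an arc
in at least one direction) is connected. In particular `D` has a vertex. -/
def IsConnected {V : Type*} (D : Digraph V) : Prop :=
  D.toSimpleGraphInclusive.Connected

/-- A subdigraph of `D`: a set of vertices together with a set of arcs of `D` between them. -/
structure Subdigraph {V : Type*} (D : Digraph V) where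
  verts : Set V
  Adj : V → V → Prop
  adj_sub : ∀ {u v : V}, Adj u v → D.Adj u v
  fst_mem : ∀ {u v : V}, Adj u v → u ∈ verts
  snd_mem : ∀ {u v : V}, Adj u v → v ∈ verts

namespace Subdigraph

variable {V : Type*} {D : Digraph V}

/-- `H'` is a subdigraph of `H` (both being subdigraphs of `D`). -/
def IsSub (H' H : D.Subdigraph) : Prop :=
  H'.verts ⊆ H.verts ∧ ∀ u v : V, H'.Adj u v → H.Adj u v

/-- The number of arcs of `H` with initial vertex `v`. -/
noncomputable def outDeg (H : D.Subdigraph) (v : V) : ℕ := {w | H.Adj v w}.ncard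

/-- The number of arcs of `H` with terminal vertex `v`. -/
noncomputable def inDeg (H : D.Subdigraph) (v : V) : ℕ := {w | H.Adj w v}.ncard

/-- Every non-empty subdigraph `H'` of `H` has a vertex whose out-degree or in-degree in `H'`
is smaller than `s`. -/
def WeaklyDegenerate (H : D.Subdigraph) (s : ℕ) : Prop :=
  ∀ H' : D.Subdigraph, H'.IsSub H → H'.verts.Nonempty →
    ∃ v ∈ H'.verts, min (H'.outDeg v) (H'.inDeg v) < s

end Subdigraph

/-- The subdigraph `D[X]` of `D` induced by the vertex set `X`. -/
def induce {V : Type*} (D : Digraph V) (X : Set V) : D.Subdigraph where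
  verts := X
  Adj u v := D.Adj u v ∧ u ∈ X ∧ v ∈ X
  adj_sub h := h.1
  fst_mem h := h.2.1
  snd_mem h := h.2.2

/-- The number of arcs of `D` with initial vertex `v`. -/
noncomputable def outDeg {V : Type*} (D : Digraph V) (v : V) : ℕ := {w | D.Adj v w}.ncard

/-- The number of arcs of `D` with terminal vertex `v`. -/
noncomputable def inDeg {V : Type*} (D : Digraph V) (v : V) : ℕ := {w | D.Adj w v}.ncard

/-- The maximum over all vertices of the in-degrees and out-degrees of `D`. -/
noncomputable def maxDeg {V : Type*} [Fintype V] (D : Digraph V) : ℕ :=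
  Finset.univ.sup fun v => max (D.outDeg v) (D.inDeg v)

/-- Every vertex has equal in-degree and out-degree. -/
def IsEulerian {V : Type*} (D : Digraph V) : Prop :=
  ∀ v, D.outDeg v = D.inDeg v

/-- The digraph obtained from the simple graph `G` by replacing each edge by two opposite arcs. -/
def bidirected {V : Type*} (G : SimpleGraph V) : Digraph V where
  Adj := G.Adj

/-- `D` is the bidirected complete graph on its vertex set. -/
def IsBidirectedComplete {V : Type*} (D : Digraph V) : Prop :=
  D = bidirected (⊤ : SimpleGraph V)

/-- `D` is a bidirected cycle of odd length `n ≥ 3`. -/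
def IsBidirectedOddCycle {V : Type*} (D : Digraph V) : Prop :=
  ∃ (G : SimpleGraph V) (n : ℕ), D = bidirected G ∧ 3 ≤ n ∧ Odd n ∧
    Nonempty (G ≃g SimpleGraph.cycleGraph n)

/-- `D` is `(L, s)`-colorable: every vertex can be given a color from its list in such a way that
every color class induces a weakly `s`-degenerate subdigraph. -/
def IsListColorable {V α : Type*} (D : Digraph V) (L : V → Finset α) (s : ℕ) : Prop :=
  ∃ φ : V → α, (∀ v, φ v ∈ L v) ∧ ∀ a : α, (D.induce {v | φ v = a}).WeaklyDegenerate s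

end Digraph

/-! For sufficiency, each exceptional digraph forces a monochromatic set in which all in- and
out-degrees are at least `s`: by pigeonhole in a complete digraph, by failure of 2-colorability on
an odd cycle, and as the whole vertex set in the `s`-regular case.

For necessity, suppose that no coloring exists. By connectivity the vertices other than any given
`v` can be colored greedily (`Tight.exists_partialColoring`). Since `v` cannot be colored, every
color of `L v` occurs exactly `s` times among its out-neighbors and exactly `s` times among its
in-neighbors (`Conf.out_spec`, `Conf.in_spec`). So degrees equal `s * #(L v)`, and lists of size one
give the `s`-regular case.

For larger lists the uncolored vertex, the hole, is treated as in a sliding puzzle: a neighbor may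
give its color to the hole and become the new hole. Sending the hole once around a cycle must
preserve the color counts at `v` (`Conf.rotate`). On an induced cycle this makes the colors
alternate. If the two colors differ, the cycle is odd and bidirected, and a detour attached to it
cannot avoid the neighborhood of the cycle vertex preceding its start (`Alternating.no_ear`).

A non-separating `v` lies on such a cycle, obtained by closing a shortest path between two
differently colored neighbors. If the cycle is longer than a triangle, no outside vertex can see all
of it, and the cycle is the whole digraph. If it is a triangle, it lies in a maximal clique, which
absorbs all neighbors and is the whole digraph. In every case moving colors between neighbors of the
hole shows that adjacent vertices have equal lists. -/

namespace Digraph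

open Finset Function
open scoped Classical

section

set_option linter.unusedSectionVars false

variable {V α : Type*} [Fintype V] {D : Digraph V} {L : V → Finset α} {s : ℕ}

/-! ### Partial colorings and greedy extension -/

/-- `φ` colors the vertices of `S` from their lists, so that every color class inside `S` induces a
weakly `s`-degenerate digraph. -/
def PartialColoring (D : Digraph V) (L : V → Finset α) (s : ℕ) (S : Finset V) (φ : V → α) : Prop :=
  (∀ u ∈ S, φ u ∈ L u) ∧
    ∀ a : α, ∀ Y ⊆ S, Y.Nonempty → (∀ y ∈ Y, φ y = a) →
      ∃ y ∈ Y, #{w ∈ Y | D.Adj y w} < s ∨ #{w ∈ Y | D.Adj w y} < s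

theorem outDeg_eq_card (D : Digraph V) (v : V) : D.outDeg v = #{w | D.Adj v w} := by
  rw [outDeg, ← Set.ncard_coe_finset]; simp

theorem inDeg_eq_card (D : Digraph V) (v : V) : D.inDeg v = #{w | D.Adj w v} := by
  rw [inDeg, ← Set.ncard_coe_finset]; simp

/-- Testing induced subdigraphs suffices, because deleting arcs only lowers degrees. -/
theorem PartialColoring.isListColorable {φ : V → α} (h : D.PartialColoring L s univ φ) :
    D.IsListColorable L s := by
  refine ⟨φ, fun v => h.1 v (mem_univ v), fun a H hH hne => ?_⟩
  obtain ⟨y, hy, hdeg⟩ := h.2 a (univ.filter (· ∈ H.verts)) (subset_univ _)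
    (by obtain ⟨x, hx⟩ := hne; exact ⟨x, by simpa using hx⟩)
    (fun y hy => hH.1 (by simpa using hy))
  refine ⟨y, by simpa using hy, min_lt_iff.2 (hdeg.imp (lt_of_le_of_lt ?_) (lt_of_le_of_lt ?_))⟩
  · rw [← Set.ncard_coe_finset]
    exact Set.ncard_le_ncard (fun w hw => by simpa using ⟨H.snd_mem hw, H.adj_sub hw⟩)
  · rw [← Set.ncard_coe_finset]
    exact Set.ncard_le_ncard (fun w hw => by simpa using ⟨H.fst_mem hw, H.adj_sub hw⟩)

theorem IsListColorable.exists_coloring (h : D.IsListColorable L s) :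
    ∃ φ : V → α, D.PartialColoring L s univ φ := by
  obtain ⟨φ, hφ, hdeg⟩ := h
  refine ⟨φ, fun v _ => hφ v, fun a Y _ hne hY => ?_⟩
  obtain ⟨y, hy, hlt⟩ := hdeg a
    { verts := Y, Adj := fun u v => D.Adj u v ∧ u ∈ Y ∧ v ∈ Y,
      adj_sub := fun h => h.1, fst_mem := fun h => h.2.1, snd_mem := fun h => h.2.2 }
    ⟨fun y hy => hY y hy, fun u v h => ⟨h.1, hY u h.2.1, hY v h.2.2⟩⟩ (by simpa using hne)
  have hy' : y ∈ Y := hy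
  refine ⟨y, hy, (min_lt_iff.1 hlt).imp (lt_of_eq_of_lt ?_) (lt_of_eq_of_lt ?_)⟩
  · rw [Subdigraph.outDeg, ← Set.ncard_coe_finset]
    congr 1; ext w; simp [hy', and_comm]
  · rw [Subdigraph.inDeg, ← Set.ncard_coe_finset]
    congr 1; ext w; simp [hy', and_comm]

theorem PartialColoring.mono {S T : Finset V} {φ : V → α} (h : D.PartialColoring L s T φ)
    (hST : S ⊆ T) : D.PartialColoring L s S φ :=
  ⟨fun u hu => h.1 u (hST hu), fun a Y hY => h.2 a Y (hY.trans hST)⟩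

/-- A monochromatic set that contains the new vertex `u` has `u` itself as a vertex of small degree;
the other sets were controlled before. -/
theorem PartialColoring.insert {S : Finset V} {φ : V → α} (h : D.PartialColoring L s S φ)
    (hloop : ∀ v, ¬ D.Adj v v) {u : V} (hu : u ∉ S) {c : α} (hc : c ∈ L u)
    (hdeg : #{w ∈ S | D.Adj u w ∧ φ w = c} < s ∨ #{w ∈ S | D.Adj w u ∧ φ w = c} < s) :
    D.PartialColoring L s (insert u S) (update φ u c) := by
  have hS : ∀ w ∈ S, update φ u c w = φ w := fun w hw =>
    update_of_ne (ne_of_mem_of_not_mem hw hu) _ _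
  refine ⟨fun w hw => ?_, fun a Y hY hne ha => ?_⟩
  · rcases mem_insert.1 hw with rfl | hw
    · simpa using hc
    · rw [hS w hw]; exact h.1 w hw
  · by_cases huY : u ∈ Y
    · have hac : a = c := by simpa using (ha u huY).symm
      subst hac
      refine ⟨u, huY, hdeg.imp (lt_of_le_of_lt (card_le_card ?_))
        (lt_of_le_of_lt (card_le_card ?_))⟩ <;>
      · intro w hw
        obtain ⟨hw, hadj⟩ := mem_filter.1 hw
        have hwS : w ∈ S := (mem_insert.1 (hY hw)).resolve_left
          (fun e => hloop u (by simpa [e] using hadj))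
        exact mem_filter.2 ⟨hwS, hadj, hS w hwS ▸ ha w hw⟩
    · have hYS : Y ⊆ S := fun y hy => (mem_insert.1 (hY hy)).resolve_left (fun e => huY (e ▸ hy))
      exact h.2 a Y hYS hne fun y hy => hS y (hYS hy) ▸ ha y hy

/-- On fewer than `s * #A` vertices, some color of `A` is used fewer than `s` times. -/
theorem exists_card_color_lt {A : Finset α} {T : Finset V} (φ : V → α) (h : #T < s * #A) :
    ∃ c ∈ A, #{w ∈ T | φ w = c} < s := by
  by_contra! hcon
  have h1 : ∑ c ∈ A, s ≤ ∑ c ∈ A, #{w ∈ T | φ w = c} := sum_le_sum hcon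
  have h2 : ∑ c ∈ A, #{w ∈ T | φ w = c} ≤ #T := by
    rw [← card_biUnion (fun c _ d _ hcd => disjoint_left.2 fun w hw hw' =>
      hcd ((mem_filter.1 hw).2.symm.trans (mem_filter.1 hw').2))]
    exact card_le_card (biUnion_subset.2 fun c _ => filter_subset _ _)
  rw [sum_const, smul_eq_mul, mul_comm] at h1
  omega

theorem PartialColoring.exists_insert {S : Finset V} {φ : V → α} (h : D.PartialColoring L s S φ)
    (hloop : ∀ v, ¬ D.Adj v v) {u : V} (hu : u ∉ S)
    (hdeg : #{w ∈ S | D.Adj u w} < s * #(L u) ∨ #{w ∈ S | D.Adj w u} < s * #(L u)) :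
    ∃ ψ : V → α, D.PartialColoring L s (Insert.insert u S) ψ := by
  rcases hdeg with hdeg | hdeg
  · obtain ⟨c, hc, hlt⟩ := exists_card_color_lt φ hdeg
    exact ⟨_, h.insert hloop hu hc (Or.inl (by rwa [filter_filter] at hlt))⟩
  · obtain ⟨c, hc, hlt⟩ := exists_card_color_lt φ hdeg
    exact ⟨_, h.insert hloop hu hc (Or.inr (by rwa [filter_filter] at hlt))⟩

/-! ### Tight digraphs and moves of the uncolored vertex -/

/-- `D` is a connected loopless digraph that is not `(L, s)`-colorable although all degrees are
bounded by `s` times the list sizes. -/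
structure Tight (D : Digraph V) (L : V → Finset α) (s : ℕ) : Prop where
  loopless : ∀ v, ¬ D.Adj v v
  connected : D.toSimpleGraphInclusive.Connected
  pos : 1 ≤ s
  out_le : ∀ v, #{w | D.Adj v w} ≤ s * #(L v)
  in_le : ∀ v, #{w | D.Adj w v} ≤ s * #(L v)
  not_colorable : ∀ φ : V → α, ¬ D.PartialColoring L s univ φ

/-- `φ` colors all vertices but `v`, which is left uncolored. -/
def Conf (D : Digraph V) (L : V → Finset α) (s : ℕ) (v : V) (φ : V → α) : Prop :=
  D.PartialColoring L s (univ.erase v) φ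

theorem adj_or_adj_of_adj {u v : V} (h : D.toSimpleGraphInclusive.Adj u v) :
    D.Adj u v ∨ D.Adj v u := ((SimpleGraph.fromRel_adj _ _ _).1 h).2

theorem Tight.adj_iff (hT : D.Tight L s) {u v : V} :
    D.toSimpleGraphInclusive.Adj u v ↔ D.Adj u v ∨ D.Adj v u := by
  refine ⟨adj_or_adj_of_adj, fun h => (SimpleGraph.fromRel_adj _ _ _).2 ⟨?_, h⟩⟩
  rintro rfl
  exact hT.loopless u (h.elim id id)

theorem exists_adj_of_mem_not_mem {G : SimpleGraph V} (hG : G.Connected) {P : V → Prop} {u v : V}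
    (hu : P u) (hv : ¬ P v) : ∃ x y, P x ∧ ¬ P y ∧ G.Adj x y := by
  obtain ⟨w⟩ := hG.preconnected u v
  obtain ⟨d, -, h1, h2⟩ := w.exists_boundary_dart {x | P x} hu hv
  exact ⟨d.fst, d.snd, h1, h2, d.adj⟩

/-- Induction on the size of `S`: color last a vertex `u` of `S` with a neighbor outside `S`. That
neighbor is uncolored, so `u` sees fewer than `s * #(L u)` colored vertices in one direction. -/
theorem Tight.exists_partialColoring (hT : D.Tight L s) (hα : Nonempty (V → α)) (S : Finset V)
    (hS : S ≠ univ) : ∃ φ : V → α, D.PartialColoring L s S φ := by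
  induction hn : #S generalizing S with
  | zero =>
    obtain ⟨φ⟩ := hα
    rw [card_eq_zero] at hn
    subst hn
    exact ⟨φ, by simp, fun a Y hY hne => absurd (subset_empty.1 hY) hne.ne_empty⟩
  | succ n ih =>
    obtain ⟨x, hx⟩ : S.Nonempty := card_pos.1 (by omega)
    obtain ⟨y, hy⟩ : ∃ y, y ∉ S := by
      by_contra! h; exact hS (eq_univ_iff_forall.2 h)
    obtain ⟨u, w, hu, hw, huw⟩ := exists_adj_of_mem_not_mem hT.connected (P := (· ∈ S)) hx hy
    obtain ⟨φ, hφ⟩ := ih (S.erase u) (fun h => notMem_erase u S (h ▸ mem_univ u))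
      (by rw [card_erase_of_mem hu]; omega)
    have hws : w ∉ S.erase u := fun h => hw (mem_of_mem_erase h)
    rw [← insert_erase hu]
    refine hφ.exists_insert hT.loopless (notMem_erase u S) ?_
    rcases adj_or_adj_of_adj huw with h | h
    · exact Or.inl (lt_of_lt_of_le (card_lt_card ((ssubset_iff_of_subset
        (filter_subset_filter _ (subset_univ _))).2 ⟨w, by simpa using h, by simp [hw]⟩))
        (hT.out_le u))
    · exact Or.inr (lt_of_lt_of_le (card_lt_card ((ssubset_iff_of_subset
        (filter_subset_filter _ (subset_univ _))).2 ⟨w, by simpa using h, by simp [hw]⟩))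
        (hT.in_le u))

theorem Conf.not_lt (hT : D.Tight L s) {v : V} {φ : V → α} (h : D.Conf L s v φ) {c : α}
    (hc : c ∈ L v) : s ≤ #{w | D.Adj v w ∧ φ w = c} ∧ s ≤ #{w | D.Adj w v ∧ φ w = c} := by
  by_contra hcon
  rw [not_and_or, not_le, not_le] at hcon
  have := h.insert hT.loopless (notMem_erase v univ) hc
    (hcon.imp (lt_of_le_of_lt (card_le_card (filter_subset_filter _ (subset_univ _))))
      (lt_of_le_of_lt (card_le_card (filter_subset_filter _ (subset_univ _)))))
  rw [insert_erase (mem_univ v)] at this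
  exact hT.not_colorable _ this

/-- If every color of `A` is used at least `s` times on `T` and `T` has at most `s * #A` elements,
then every color of `A` is used exactly `s` times, and no other color is used. -/
theorem card_color_eq_of_le {A : Finset α} {T : Finset V} {φ : V → α} (h : #T ≤ s * #A)
    (hA : ∀ c ∈ A, s ≤ #{w ∈ T | φ w = c}) :
    #T = s * #A ∧ (∀ c ∈ A, #{w ∈ T | φ w = c} = s) ∧ ∀ w ∈ T, φ w ∈ A := by
  have h1 : ∑ c ∈ A, s ≤ ∑ c ∈ A, #{w ∈ T | φ w = c} := sum_le_sum hA
  have h3 : #(A.biUnion fun c => {w ∈ T | φ w = c}) = ∑ c ∈ A, #{w ∈ T | φ w = c} :=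
    card_biUnion (fun c _ d _ hcd => disjoint_left.2 fun w hw hw' =>
      hcd ((mem_filter.1 hw).2.symm.trans (mem_filter.1 hw').2))
  have hsub : (A.biUnion fun c => {w ∈ T | φ w = c}) ⊆ T :=
    biUnion_subset.2 fun c _ => filter_subset _ _
  have h2 := card_le_card hsub
  have h4 : ∑ c ∈ A, s = s * #A := by rw [sum_const, smul_eq_mul, mul_comm]
  refine ⟨by omega, fun c hc => ?_, fun w hw => ?_⟩
  · exact (((sum_eq_sum_iff_of_le hA).1 (by omega)) c hc).symm
  · rw [← eq_of_subset_of_card_le hsub (by omega)] at hw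
    obtain ⟨c, hc, hw⟩ := mem_biUnion.1 hw
    exact (mem_filter.1 hw).2 ▸ hc

theorem Conf.out_spec (hT : D.Tight L s) {v : V} {φ : V → α} (h : D.Conf L s v φ) :
    #{w | D.Adj v w} = s * #(L v) ∧ (∀ c ∈ L v, #{w | D.Adj v w ∧ φ w = c} = s) ∧
      ∀ w, D.Adj v w → φ w ∈ L v := by
  have := card_color_eq_of_le (φ := φ) (hT.out_le v) fun c hc => by
    rw [filter_filter]; exact (h.not_lt hT hc).1
  simpa [filter_filter] using this

theorem Conf.in_spec (hT : D.Tight L s) {v : V} {φ : V → α} (h : D.Conf L s v φ) :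
    #{w | D.Adj w v} = s * #(L v) ∧ (∀ c ∈ L v, #{w | D.Adj w v ∧ φ w = c} = s) ∧
      ∀ w, D.Adj w v → φ w ∈ L v := by
  have := card_color_eq_of_le (φ := φ) (hT.in_le v) fun c hc => by
    rw [filter_filter]; exact (h.not_lt hT hc).2
  simpa [filter_filter] using this

theorem Conf.mem_list (hT : D.Tight L s) {v w : V} {φ : V → α} (h : D.Conf L s v φ)
    (hw : D.toSimpleGraphInclusive.Adj v w) : φ w ∈ L v :=
  (adj_or_adj_of_adj hw).elim ((h.out_spec hT).2.2 w) ((h.in_spec hT).2.2 w)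

theorem Conf.mem_list_self {v w : V} {φ : V → α} (h : D.Conf L s v φ)
    (hw : w ≠ v) : φ w ∈ L w := h.1 w (mem_erase.2 ⟨hw, mem_univ w⟩)

theorem Conf.exists_adj_color (hT : D.Tight L s) {v : V} {φ : V → α} (h : D.Conf L s v φ)
    {c : α} (hc : c ∈ L v) : ∃ w, D.toSimpleGraphInclusive.Adj v w ∧ φ w = c := by
  have h1 := (h.out_spec hT).2.1 c hc
  have h2 := hT.pos
  obtain ⟨w, hw⟩ := card_pos.1 (show 0 < #{w | D.Adj v w ∧ φ w = c} by omega)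
  simp only [mem_filter, mem_univ, true_and] at hw
  exact ⟨w, hT.adj_iff.2 (Or.inl hw.1), hw.2⟩

/-- The counts do not depend on the coloring: they are `s` for colors in `L v` and zero for all
others. Comparing them before and after a move drives the whole argument. -/
theorem Conf.card_congr (hT : D.Tight L s) {v : V} {φ ψ : V → α} (h : D.Conf L s v φ)
    (h' : D.Conf L s v ψ) (c : α) :
    #{w | D.Adj v w ∧ φ w = c} = #{w | D.Adj v w ∧ ψ w = c} ∧
      #{w | D.Adj w v ∧ φ w = c} = #{w | D.Adj w v ∧ ψ w = c} := by
  by_cases hc : c ∈ L v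
  · rw [(h.out_spec hT).2.1 c hc, (h'.out_spec hT).2.1 c hc, (h.in_spec hT).2.1 c hc,
      (h'.in_spec hT).2.1 c hc]
    exact ⟨rfl, rfl⟩
  · have h1 := (h.out_spec hT).2.2
    have h2 := (h'.out_spec hT).2.2
    have h3 := (h.in_spec hT).2.2
    have h4 := (h'.in_spec hT).2.2
    constructor
    all_goals
      rw [filter_eq_empty_iff.2, filter_eq_empty_iff.2]
      all_goals
        rintro w - ⟨hw, rfl⟩
        first | exact hc (h1 w hw) | exact hc (h2 w hw) | exact hc (h3 w hw) | exact hc (h4 w hw)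

/-- The uncolored vertex may be moved to a neighbor. -/
theorem Conf.shift (hT : D.Tight L s) {v u : V} {φ : V → α} (h : D.Conf L s v φ)
    (huv : D.toSimpleGraphInclusive.Adj v u) : D.Conf L s u (update φ v (φ u)) := by
  have hne : u ≠ v := huv.ne'
  have hc := h.mem_list hT huv
  have hS : univ.erase u = Insert.insert v ((univ.erase u).erase v) :=
    (insert_erase (mem_erase.2 ⟨hne.symm, mem_univ v⟩)).symm
  unfold Conf
  rw [hS]
  refine PartialColoring.insert (PartialColoring.mono h (by
    rw [erase_right_comm]; exact erase_subset _ _)) hT.loopless (notMem_erase _ _) hc ?_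
  -- The color `φ u` was seen exactly `s` times from `v` in each direction; `u` has now lost it,
  -- which leaves fewer than `s` in a direction of an arc joining `v` and `u`.
  rcases adj_or_adj_of_adj huv with ha | ha
  · left
    rw [← (h.out_spec hT).2.1 _ hc]
    exact card_lt_card ((ssubset_iff_of_subset
      (filter_subset_filter _ (subset_univ _))).2 ⟨u, by simpa using ha, by simp⟩)
  · right
    rw [← (h.in_spec hT).2.1 _ hc]
    exact card_lt_card ((ssubset_iff_of_subset
      (filter_subset_filter _ (subset_univ _))).2 ⟨u, by simpa using ha, by simp⟩)

theorem card_filter_eq_add {P : V → Prop} [DecidablePred P] {x z : V} (hxz : x ≠ z) :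
    #{w | P w} = (if P x then 1 else 0) + ((if P z then 1 else 0) +
      ∑ w ∈ (univ.erase x).erase z, if P w then 1 else 0) := by
  rw [card_filter, ← add_sum_erase univ _ (mem_univ x),
    ← add_sum_erase (univ.erase x) _ (mem_erase.2 ⟨hxz.symm, mem_univ z⟩)]

/-- When a recoloring changes only `x` and `z` among the vertices counted, the contributions of
these two must balance. -/
theorem indicator_add_eq {P : V → Prop} {x z : V} (hxz : x ≠ z) {φ ψ : V → α}
    (hφ : ∀ w, P w → w ≠ x → w ≠ z → ψ w = φ w) {c : α}
    (h : #{w | P w ∧ φ w = c} = #{w | P w ∧ ψ w = c}) :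
    (if P x ∧ φ x = c then 1 else 0) + (if P z ∧ φ z = c then 1 else 0) =
      (if P x ∧ ψ x = c then 1 else 0) + (if P z ∧ ψ z = c then 1 else 0) := by
  rw [card_filter_eq_add hxz, card_filter_eq_add hxz] at h
  have : ∑ w ∈ (univ.erase x).erase z, (if P w ∧ φ w = c then 1 else 0) =
      ∑ w ∈ (univ.erase x).erase z, if P w ∧ ψ w = c then 1 else 0 := by
    refine sum_congr rfl fun w hw => ?_
    simp only [mem_erase, mem_univ, and_true] at hw
    by_cases hP : P w
    · rw [hφ w hP hw.2 hw.1]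
    · simp [hP]
  omega

/-- The uncolored vertex may be moved along a path. -/
theorem Conf.move (hT : D.Tight L s) (l : List V) {v : V} {φ : V → α} (h : D.Conf L s v φ)
    (hch : List.IsChain D.toSimpleGraphInclusive.Adj (v :: l)) (hnd : (v :: l).Nodup) :
    ∃ ψ : V → α, (∀ z ∈ (v :: l).getLast?, D.Conf L s z ψ) ∧ (∀ w ∉ v :: l, ψ w = φ w) ∧
      (v :: l).dropLast.map ψ = l.map φ := by
  induction l generalizing v φ with
  | nil => exact ⟨φ, by simpa using h, fun _ _ => rfl, by simp⟩
  | cons x l ih =>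
    rw [List.isChain_cons_cons] at hch
    rw [List.nodup_cons] at hnd
    obtain ⟨ψ, h1, h2, h3⟩ := ih (h.shift hT hch.1) hch.2 hnd.2
    refine ⟨ψ, by simpa using h1, fun w hw => ?_, ?_⟩
    · rw [List.mem_cons, not_or] at hw
      rw [h2 w hw.2, update_of_ne hw.1]
    · rw [List.dropLast_cons_cons, List.map_cons, List.map_cons, h3, h2 v hnd.1, update_self]
      congr 1
      refine List.map_congr_left fun w hw => update_of_ne ?_ _ _
      rintro rfl
      exact hnd.1 (List.mem_cons_of_mem _ hw)

/-- The uncolored vertex may be moved around a cycle on which it has no chords. -/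
theorem Conf.rotate (hT : D.Tight L s) {l : List V} {v x y z : V} {φ : V → α}
    (h : D.Conf L s v φ)
    (hch : List.IsChain D.toSimpleGraphInclusive.Adj (v :: x :: y :: l))
    (hnd : (v :: x :: y :: l).Nodup) (hz : z ∈ (y :: l).getLast?)
    (hzv : D.toSimpleGraphInclusive.Adj z v)
    (hint : ∀ w ∈ y :: l, D.toSimpleGraphInclusive.Adj v w → w = z) :
    φ y = φ z ∧ (φ x ≠ φ z → ((D.Adj v x ↔ D.Adj v z) ∧ (D.Adj x v ↔ D.Adj z v))) ∧
      ∃ ψ : V → α, D.Conf L s v ψ ∧ ψ x = φ z ∧ ψ z = φ x ∧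
        ∀ w ∉ v :: x :: y :: l, ψ w = φ w := by
  have hzl : z ∈ y :: l := List.mem_of_getLast? hz
  have hvx := (List.isChain_cons_cons.1 hch).1
  -- The hole goes along the path to `z` and then back to `v`. Colors shift by one place: `x`
  -- receives `φ y`, and `z` receives `φ x` by way of `v`.
  obtain ⟨ψ, h1, h2, h3⟩ := h.move hT _ hch hnd
  have hψz : D.Conf L s z ψ := h1 z (by simpa using hz)
  have hψ := hψz.shift hT hzv
  simp only [List.dropLast_cons_cons, List.map_cons, List.cons.injEq] at h3
  have hnv : v ∉ x :: y :: l := (List.nodup_cons.1 hnd).1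
  have hxl : x ∉ y :: l := (List.nodup_cons.1 (List.nodup_cons.1 hnd).2).1
  have hxz : x ≠ z := fun e => hxl (e ▸ hzl)
  have hx : update ψ z (ψ v) x = φ y := by rw [update_of_ne hxz, h3.2.1]
  have hz' : update ψ z (ψ v) z = φ x := by rw [update_self, h3.1]
  have hout : ∀ w ∉ v :: x :: y :: l, update ψ z (ψ v) w = φ w := fun w hw => by
    rw [update_of_ne, h2 w hw]
    rintro rfl
    exact hw (by simp only [List.mem_cons] at hzl ⊢; tauto)
  have hnbr : ∀ w, D.Adj v w ∨ D.Adj w v → w ≠ x → w ≠ z → update ψ z (ψ v) w = φ w := by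
    intro w hw hwx hwz
    have hadj := hT.adj_iff.2 hw
    refine hout w fun hmem => ?_
    rcases List.mem_cons.1 hmem with rfl | hmem
    · exact hadj.ne rfl
    · rcases List.mem_cons.1 hmem with rfl | hmem
      · exact hwx rfl
      · exact hwz (hint w hmem hadj)
  have e1 := fun c => indicator_add_eq hxz (P := D.Adj v)
    (fun w hw => hnbr w (Or.inl hw)) (h.card_congr hT hψ c).1
  have e2 := fun c => indicator_add_eq hxz (P := (D.Adj · v))
    (fun w hw => hnbr w (Or.inr hw)) (h.card_congr hT hψ c).2
  simp only [hx, hz'] at e1 e2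
  have o1 := adj_or_adj_of_adj hvx
  have o2 := adj_or_adj_of_adj hzv
  -- Otherwise a count changes: if `φ x = φ z`, this color is lost at `x`; if not, the color `φ z`
  -- is lost at `z` and gained at neither vertex.
  have hyz : φ y = φ z := by
    by_contra hne
    by_cases q : φ x = φ z
    · have hyx : φ y ≠ φ x := fun e => hne (e.trans q)
      have a := e1 (φ x)
      have b := e2 (φ x)
      rw [← q] at a b
      simp only [hyx, and_false, and_true, if_false] at a b
      rcases o1 with o | o
      · simp only [o, if_true] at a; omega
      · simp only [o, if_true] at b; omega
    · have a := e1 (φ z)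
      have b := e2 (φ z)
      simp only [q, hne, and_false, and_true, if_false] at a b
      rcases o2 with o | o
      · simp [o] at b
      · simp [o] at a
  refine ⟨hyz, fun hne => ?_, _, hψ, hx.trans hyz, hz', hout⟩
  -- The color `φ z` sits only on `z` before the rotation and only on `x` after it, so the arcs
  -- between `v` and these two vertices must match.
  have a := e1 (φ z)
  have b := e2 (φ z)
  simp only [hne, hyz, and_false, and_true, if_false] at a b
  constructor
  · by_cases p : D.Adj v x <;> by_cases p' : D.Adj v z <;> simp_all
  · by_cases p : D.Adj x v <;> by_cases p' : D.Adj z v <;> simp_all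

/-! ### Rotation around induced cycles -/

/-- `p` runs once around an induced cycle of `G` of length `n`. -/
structure IsInducedCycle (G : SimpleGraph V) (n : ℕ) (p : ZMod n → V) : Prop where
  three_le : 3 ≤ n
  inj : Injective p
  adj_iff : ∀ i j, G.Adj (p i) (p j) ↔ j = i + 1 ∨ i = j + 1

/-- The list `p a, p (a + 1), …, p (a + k - 1)`. -/
def arc {n : ℕ} (p : ZMod n → V) (a k : ℕ) : List V :=
  (List.range' a k).map fun i : ℕ => p (i : ZMod n)

theorem natCast_inj_of_lt {n i j : ℕ} (hi : i < n) (hj : j < n)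
    (h : (i : ZMod n) = (j : ZMod n)) : i = j := by
  rwa [ZMod.natCast_eq_natCast_iff', Nat.mod_eq_of_lt hi, Nat.mod_eq_of_lt hj] at h

theorem mem_arc {n : ℕ} {p : ZMod n → V} {a k : ℕ} {w : V} :
    w ∈ arc p a k ↔ ∃ i : ℕ, (a ≤ i ∧ i < a + k) ∧ p i = w := by
  simp [arc, List.mem_range'_1]

theorem mem_range_of_mem_arc {n : ℕ} {p : ZMod n → V} {a k : ℕ} {w : V} (h : w ∈ arc p a k) :
    w ∈ Set.range p := by
  obtain ⟨i, -, rfl⟩ := mem_arc.1 h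
  exact ⟨_, rfl⟩

theorem arc_succ {n : ℕ} (p : ZMod n → V) (a k : ℕ) :
    arc p a (k + 1) = p a :: arc p (a + 1) k := by
  simp [arc, List.range'_succ]

theorem getLast_arc {n : ℕ} (p : ZMod n → V) (a k : ℕ) :
    (arc p a (k + 1)).getLast? = some (p ((a + k : ℕ) : ZMod n)) := by
  simp [arc, List.range'_concat]

namespace IsInducedCycle

variable {G : SimpleGraph V} {n : ℕ} {p : ZMod n → V}

theorem nodup_arc (hC : IsInducedCycle G n p) {a k : ℕ} (h : a + k ≤ n) : (arc p a k).Nodup := by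
  refine List.Nodup.map_on (fun i hi j hj hij => ?_) (List.nodup_range' (step := 1))
  rw [List.mem_range'_1] at hi hj
  exact natCast_inj_of_lt (by omega) (by omega) (hC.inj hij)

theorem isChain_arc (hC : IsInducedCycle G n p) (a k : ℕ) : List.IsChain G.Adj (arc p a k) := by
  induction k generalizing a with
  | zero => simp [arc]
  | succ k ih =>
    rw [arc_succ, List.isChain_cons]
    refine ⟨fun y hy => ?_, ih _⟩
    cases k with
    | zero => simp [arc] at hy
    | succ k =>
      rw [arc_succ, List.head?_cons, Option.mem_some_iff] at hy
      subst hy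
      rw [hC.adj_iff]
      left; push_cast; rfl

theorem adj_succ (hC : IsInducedCycle G n p) (i : ZMod n) : G.Adj (p i) (p (i + 1)) :=
  (hC.adj_iff _ _).2 (Or.inl rfl)

theorem adj_pred (hC : IsInducedCycle G n p) (i : ZMod n) : G.Adj (p i) (p (i - 1)) :=
  (hC.adj_iff _ _).2 (Or.inr (by ring))

theorem shift (hC : IsInducedCycle G n p) (c : ZMod n) :
    IsInducedCycle G n fun i => p (i + c) where
  three_le := hC.three_le
  inj := fun i j h => add_right_cancel (hC.inj h)
  adj_iff := fun i j => by
    rw [hC.adj_iff, add_right_comm, add_right_comm j, add_left_inj, add_left_inj]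

theorem reverse (hC : IsInducedCycle G n p) : IsInducedCycle G n fun i => p (-i) where
  three_le := hC.three_le
  inj := fun i j h => neg_injective (hC.inj h)
  adj_iff := fun i j => by
    rw [hC.adj_iff, or_comm]
    refine or_congr ⟨fun h => ?_, fun h => ?_⟩ ⟨fun h => ?_, fun h => ?_⟩
    · linear_combination h
    · linear_combination h
    · linear_combination h
    · linear_combination h

theorem natCast_ne_zero (hC : IsInducedCycle G n p) {i : ℕ} (h0 : 0 < i) (hi : i < n) :
    (i : ZMod n) ≠ 0 := fun h => by
  have := natCast_inj_of_lt (j := 0) hi (by omega) (by simpa using h)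
  omega

theorem one_ne_zero (hC : IsInducedCycle G n p) : (1 : ZMod n) ≠ 0 := by
  have := hC.three_le
  simpa using hC.natCast_ne_zero (i := 1) (by omega) (by omega)

theorem two_ne_zero (hC : IsInducedCycle G n p) : (2 : ZMod n) ≠ 0 := by
  have := hC.three_le
  simpa using hC.natCast_ne_zero (i := 2) (by omega) (by omega)

theorem natCast_pred (hC : IsInducedCycle G n p) : ((n - 1 : ℕ) : ZMod n) = -1 := by
  have := hC.three_le
  rw [Nat.cast_sub (by omega)]; simp

/-- The bound `2 ≤ a` excludes `p 1`, the only other cycle neighbor of `p 0`. -/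
theorem eq_of_adj_arc (hC : IsInducedCycle G n p) {a k : ℕ} (ha : 2 ≤ a) (hk : a + k ≤ n)
    {w : V} (hw : w ∈ arc p a k) (hadj : G.Adj (p 0) w) : w = p (-1) := by
  obtain ⟨i, hi, rfl⟩ := mem_arc.1 hw
  rcases (hC.adj_iff _ _).1 hadj with h | h
  · have := natCast_inj_of_lt (i := i) (j := 1) (n := n) (by omega) (by omega) (by simpa using h)
    omega
  · congr 1
    exact (neg_eq_of_add_eq_zero_left h.symm).symm

/-- Moving the uncolored vertex once around an induced cycle. -/
theorem rotate {p : ZMod n → V} (hC : IsInducedCycle D.toSimpleGraphInclusive n p)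
    (hT : D.Tight L s) {φ : V → α} (h : D.Conf L s (p 0) φ) :
    φ (p 2) = φ (p (-1)) ∧
      (φ (p 1) ≠ φ (p (-1)) → ((D.Adj (p 0) (p 1) ↔ D.Adj (p 0) (p (-1))) ∧
        (D.Adj (p 1) (p 0) ↔ D.Adj (p (-1)) (p 0)))) ∧
      ∃ ψ : V → α, D.Conf L s (p 0) ψ ∧ ψ (p 1) = φ (p (-1)) ∧ ψ (p (-1)) = φ (p 1) ∧
        ∀ w ∉ Set.range p, ψ w = φ w := by
  have h3 := hC.three_le
  obtain ⟨m, rfl⟩ : ∃ m, n = m + 3 := ⟨n - 3, by omega⟩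
  have harc : arc p 0 (m + 3) = p 0 :: p 1 :: p 2 :: arc p 3 m := by
    rw [arc_succ, arc_succ, arc_succ]; norm_num
  have harc2 : arc p 2 (m + 1) = p 2 :: arc p 3 m := by
    rw [arc_succ]; norm_num
  obtain ⟨h1, h2, ψ, h3, h4, h5, h6⟩ := h.rotate hT (z := p (-1)) (harc ▸ hC.isChain_arc 0 (m + 3))
    (harc ▸ hC.nodup_arc (by omega))
    (by rw [← harc2, getLast_arc, Option.mem_some_iff, ← hC.natCast_pred]; congr 2; omega)
    ((hC.adj_iff _ _).2 (Or.inl (by ring)))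
    (fun w hw => hC.eq_of_adj_arc (k := m + 1) le_rfl (by omega) (harc2 ▸ hw))
  refine ⟨h1, h2, ψ, h3, h4, h5, fun w hw => h6 w fun hm => hw ?_⟩
  rw [← harc] at hm
  exact mem_range_of_mem_arc hm

end IsInducedCycle

/-! ### Alternating cycles -/

/-- Some coloring of all vertices but `p 0` gives different colors to the two neighbors of `p 0`
on the cycle `p`. -/
def Alternating (D : Digraph V) (L : V → Finset α) (s : ℕ) {n : ℕ} (p : ZMod n → V) : Prop :=
  ∃ φ : V → α, D.Conf L s (p 0) φ ∧ φ (p 1) ≠ φ (p (-1))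

variable {n : ℕ} {p : ZMod n → V}

theorem Alternating.reverse (h : D.Alternating L s p) :
    D.Alternating L s fun i => p (-i) := by
  obtain ⟨φ, h1, h2⟩ := h
  exact ⟨φ, by simpa using h1, by simpa using h2.symm⟩

theorem IsInducedCycle.step (hC : IsInducedCycle D.toSimpleGraphInclusive n p) (hT : D.Tight L s)
    {φ : V → α} (h : D.Conf L s (p 0) φ) :
    ∃ ψ : V → α, D.Conf L s (p 1) ψ ∧ ψ (p 0) = φ (p 1) ∧ ψ (p 2) = φ (p (-1)) ∧
      ∀ w ≠ p 0, ψ w = φ w := by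
  have hadj := hC.adj_succ 0
  rw [zero_add] at hadj
  refine ⟨_, h.shift hT hadj, by simp, ?_, fun w hw => update_of_ne hw _ _⟩
  rw [update_of_ne (hC.inj.ne hC.two_ne_zero), (hC.rotate hT h).1]

/-- One step of the hole along the cycle turns the colors of its successor and predecessor into
those of the new predecessor and successor, so they still differ. -/
theorem Alternating.shift (h : D.Alternating L s p)
    (hC : IsInducedCycle D.toSimpleGraphInclusive n p) (hT : D.Tight L s) (c : ZMod n) :
    D.Alternating L s fun i => p (i + c) := by
  have : NeZero n := ⟨by have := hC.three_le; omega⟩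
  have key : ∀ k : ℕ, D.Alternating L s fun i => p (i + (k : ZMod n)) := by
    intro k
    induction k with
    | zero => simpa using h
    | succ k ih =>
      obtain ⟨φ, h1, h2⟩ := ih
      obtain ⟨ψ, h3, h4, h5, -⟩ := (hC.shift (k : ZMod n)).step hT h1
      refine ⟨ψ, ?_, ?_⟩
      · convert h3 using 2; push_cast; ring
      · have e1 : (1 : ZMod n) + ((k + 1 : ℕ) : ZMod n) = 2 + k := by push_cast; ring
        have e2 : (-1 : ZMod n) + ((k + 1 : ℕ) : ZMod n) = 0 + k := by push_cast; ring
        simp only [e1, e2]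
        rw [h4, h5]
        exact h2.symm
  have := key c.val
  rwa [ZMod.natCast_zmod_val] at this

/-- Rotation gives `φ (p 2) = φ (p (-1))`; advancing the hole repeats this along the cycle. -/
theorem IsInducedCycle.color_eq (hT : D.Tight L s) (j : ℕ) :
    ∀ {p : ZMod n → V} {φ : V → α}, IsInducedCycle D.toSimpleGraphInclusive n p →
      D.Conf L s (p 0) φ → j + 1 < n →
      φ (p ((j + 1 : ℕ) : ZMod n)) = if Even j then φ (p 1) else φ (p (-1)) := by
  induction j with
  | zero => intro p φ hC h hj; simp
  | succ j ih =>
    intro p φ hC h hj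
    obtain ⟨ψ, h1, h2, h3, h4⟩ := hC.step hT h
    have := ih (hC.shift 1) (by simpa using h1) (by omega)
    have e1 : ((j + 1 : ℕ) : ZMod n) + 1 = ((j + 1 + 1 : ℕ) : ZMod n) := by push_cast; ring
    rw [e1, h4 _ (hC.inj.ne (hC.natCast_ne_zero (by omega) hj))] at this
    rw [this, one_add_one_eq_two, neg_add_cancel, h2, h3]
    by_cases hj : Even j <;> simp [hj, Nat.even_add_one]

/-- In an even cycle the alternating pattern would give the last vertex `p (-1)` the color of `p 1`.
-/
theorem Alternating.odd (h : D.Alternating L s p)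
    (hC : IsInducedCycle D.toSimpleGraphInclusive n p) (hT : D.Tight L s) : Odd n := by
  have h3 := hC.three_le
  obtain ⟨φ, h1, h2⟩ := h
  have := IsInducedCycle.color_eq hT (n - 2) hC h1 (by omega)
  rw [show n - 2 + 1 = n - 1 by omega, hC.natCast_pred] at this
  by_cases he : Even (n - 2)
  · rw [if_pos he] at this; exact absurd this.symm h2
  · rw [Nat.not_even_iff_odd] at he
    obtain ⟨k, hk⟩ := he
    exact ⟨k + 1, by omega⟩

theorem Alternating.adj_iff (h : D.Alternating L s p)
    (hC : IsInducedCycle D.toSimpleGraphInclusive n p) (hT : D.Tight L s) (i : ZMod n) :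
    (D.Adj (p i) (p (i + 1)) ↔ D.Adj (p i) (p (i - 1))) ∧
      (D.Adj (p (i + 1)) (p i) ↔ D.Adj (p (i - 1)) (p i)) := by
  obtain ⟨φ, h1, h2⟩ := h.shift hC hT i
  have := ((hC.shift i).rotate hT h1).2.1 h2
  simp only [zero_add] at this
  rwa [add_comm 1 i, neg_add_eq_sub] at this

/-- By `Alternating.adj_iff`, the roles of forward and backward arcs are exchanged from each edge to
the next. After an odd number `n` of steps the same edge returns with its roles exchanged, so either
arc implies the other. -/
theorem Alternating.bidirected (h : D.Alternating L s p)
    (hC : IsInducedCycle D.toSimpleGraphInclusive n p) (hT : D.Tight L s) (i : ZMod n) :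
    D.Adj (p i) (p (i + 1)) ∧ D.Adj (p (i + 1)) (p i) := by
  have key : ∀ k : ℕ, ∀ i : ZMod n, (D.Adj (p (i + k)) (p (i + k + 1)) ↔
      if Even k then D.Adj (p i) (p (i + 1)) else D.Adj (p (i + 1)) (p i)) ∧
      (D.Adj (p (i + k + 1)) (p (i + k)) ↔
      if Even k then D.Adj (p (i + 1)) (p i) else D.Adj (p i) (p (i + 1))) := by
    intro k
    induction k with
    | zero => intro i; simp
    | succ k ih =>
      intro i
      have a := h.adj_iff hC hT (i + (k + 1 : ℕ))
      have e : i + ((k + 1 : ℕ) : ZMod n) - 1 = i + k := by push_cast; ring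
      have e' : i + ((k + 1 : ℕ) : ZMod n) = i + k + 1 := by push_cast; ring
      rw [e] at a
      rw [a.1, a.2, e', (ih i).1, (ih i).2]
      by_cases hk : Even k <;> simp [hk, Nat.even_add_one]
  have := (key n i).1
  rw [if_neg (Nat.not_even_iff_odd.2 (h.odd hC hT))] at this
  simp only [CharP.cast_eq_zero, add_zero] at this
  have ho := adj_or_adj_of_adj (hC.adj_succ i)
  tauto

/-- A path outside an alternating cycle cannot join the successor of `p 0` to another vertex of the
cycle if it avoids the neighborhood of `p 0`. -/
theorem Alternating.no_ear (h : D.Alternating L s p)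
    (hC : IsInducedCycle D.toSimpleGraphInclusive n p) (hT : D.Tight L s) {x : V} {Q : List V}
    (hch : List.IsChain D.toSimpleGraphInclusive.Adj (x :: Q)) (hnd : (x :: Q).Nodup)
    (hQ : ∀ q ∈ x :: Q, q ∉ Set.range p)
    (hQ0 : ∀ q ∈ x :: Q, ¬ D.toSimpleGraphInclusive.Adj (p 0) q)
    (hx : D.toSimpleGraphInclusive.Adj (p 1) x) {j : ZMod n} (hj0 : j ≠ 0) (hj1 : j ≠ 1)
    (hlast : ∀ e ∈ (x :: Q).getLast?, D.toSimpleGraphInclusive.Adj e (p j)) : False := by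
  have h3 := hC.three_le
  have : NeZero n := ⟨by omega⟩
  obtain ⟨j, hjn, rfl⟩ : ∃ k : ℕ, k < n ∧ (k : ZMod n) = j :=
    ⟨j.val, j.val_lt, ZMod.natCast_zmod_val j⟩
  have hj2 : 2 ≤ j := by
    by_contra! hlt
    interval_cases j
    · exact hj0 (by simp)
    · exact hj1 (by simp)
  obtain ⟨m, hm⟩ : ∃ m, n = j + (m + 1) := ⟨n - j - 1, by omega⟩
  -- Rotate around the detour cycle `p 0, p 1, x, Q, p j, …, p (-1)`, on which `p 0` has no chords.
  have key : ∀ φ : V → α, D.Conf L s (p 0) φ → φ x = φ (p (-1)) := by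
    intro φ hφ
    have hchain : List.IsChain D.toSimpleGraphInclusive.Adj
        (p 0 :: p 1 :: x :: (Q ++ arc p j (m + 1))) := by
      have hadj := hC.adj_succ 0
      rw [zero_add] at hadj
      refine List.isChain_cons_cons.2 ⟨hadj, List.isChain_cons_cons.2 ⟨hx, ?_⟩⟩
      rw [← List.cons_append, List.isChain_append]
      refine ⟨hch, hC.isChain_arc _ _, fun e he y hy => ?_⟩
      rw [arc_succ, List.head?_cons, Option.mem_some_iff] at hy
      exact hy ▸ hlast e he
    have hnodup : (p 0 :: p 1 :: x :: (Q ++ arc p j (m + 1))).Nodup := by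
      have hmem : ∀ k : ℕ, k < 2 → p k ∉ x :: (Q ++ arc p j (m + 1)) := by
        intro k hk hmem
        rw [← List.cons_append, List.mem_append] at hmem
        rcases hmem with hmem | hmem
        · exact hQ _ hmem ⟨_, rfl⟩
        · obtain ⟨i, hi, hik⟩ := mem_arc.1 hmem
          have := natCast_inj_of_lt (by omega) (by omega) (hC.inj hik)
          omega
      rw [List.nodup_cons, List.nodup_cons, ← List.cons_append, List.nodup_append]
      refine ⟨?_, ?_, hnd, hC.nodup_arc (by omega), fun a ha b hb hab => ?_⟩
      · rw [List.mem_cons, not_or]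
        refine ⟨hC.inj.ne hC.one_ne_zero.symm, ?_⟩
        simpa using hmem 0 (by omega)
      · simpa using hmem 1 (by omega)
      · exact hQ a ha (hab ▸ mem_range_of_mem_arc hb)
    refine (hφ.rotate hT (z := p (-1)) hchain hnodup ?_ ?_ ?_).1
    · rw [← List.cons_append, List.getLast?_append, getLast_arc, Option.some_or,
        Option.mem_some_iff, ← hC.natCast_pred]
      congr 2; omega
    · exact (hC.adj_iff _ _).2 (Or.inl (by ring))
    · intro w hw hadj
      rw [← List.cons_append, List.mem_append] at hw
      rcases hw with hw | hw
      · exact absurd hadj (hQ0 w hw)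
      · exact hC.eq_of_adj_arc hj2 (by omega) hw hadj
  obtain ⟨φ, h1, h2⟩ := h
  -- Rotating around `p` itself gives `p (-1)` a different color but leaves `x` unchanged, which
  -- contradicts `key`.
  obtain ⟨-, -, ψ, h4, -, h6, h7⟩ := hC.rotate hT h1
  have e1 := key φ h1
  have e2 := key ψ h4
  rw [h6, h7 x (hQ x (by simp))] at e2
  exact h2 (e2.symm.trans e1)

/-- A vertex with two neighbors on an alternating cycle is adjacent to the whole cycle. -/
theorem Alternating.adj_all (h : D.Alternating L s p)
    (hC : IsInducedCycle D.toSimpleGraphInclusive n p) (hT : D.Tight L s) {x : V}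
    (hx : x ∉ Set.range p) {i j : ZMod n} (hij : i ≠ j)
    (hi : D.toSimpleGraphInclusive.Adj x (p i)) (hj : D.toSimpleGraphInclusive.Adj x (p j))
    (k : ZMod n) : D.toSimpleGraphInclusive.Adj x (p k) := by
  have : NeZero n := ⟨by have := hC.three_le; omega⟩
  -- If `x` missed `p k`, then `x` alone would be a forbidden detour from `p (k + 1)` to another
  -- neighbor `p g`.
  have key : ∀ k, D.toSimpleGraphInclusive.Adj x (p (k + 1)) →
      D.toSimpleGraphInclusive.Adj x (p k) := by
    intro k hk
    by_contra hcon
    obtain ⟨g, hg, hgk⟩ : ∃ g, D.toSimpleGraphInclusive.Adj x (p g) ∧ g ≠ k + 1 := by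
      by_cases hik : i = k + 1
      · exact ⟨j, hj, fun e => hij (hik.trans e.symm)⟩
      · exact ⟨i, hi, hik⟩
    refine (h.shift hC hT k).no_ear (hC.shift k) hT (x := x) (Q := []) (j := g - k)
      (List.isChain_singleton _) (by simp) ?_ ?_ ?_ ?_ ?_ ?_
    · simp only [List.mem_singleton, forall_eq]
      rintro ⟨i, rfl⟩
      exact hx ⟨_, rfl⟩
    · simpa using fun h => hcon h.symm
    · rw [add_comm]; exact hk.symm
    · intro e
      rw [sub_eq_zero.1 e] at hg
      exact hcon hg
    · intro e; exact hgk (by linear_combination e)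
    · simpa using hg
  have key' : ∀ m : ℕ, D.toSimpleGraphInclusive.Adj x (p (i - m)) := by
    intro m
    induction m with
    | zero => simpa using hi
    | succ m ih =>
      apply key
      convert ih using 2
      push_cast; ring
  have := key' (i - k).val
  rwa [ZMod.natCast_zmod_val, sub_sub_cancel] at this

/-! ### Non-separating vertices and ears -/

/-- The graph obtained from `G` by removing all edges that meet `B`. -/
def avoid (G : SimpleGraph V) (B : Set V) : SimpleGraph V where
  Adj a b := G.Adj a b ∧ a ∉ B ∧ b ∉ B
  symm := ⟨fun _ _ h => ⟨h.1.symm, h.2.2, h.2.1⟩⟩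
  loopless := ⟨fun _ h => h.1.ne rfl⟩

theorem not_mem_of_mem_support {G : SimpleGraph V} {B : Set V} {x y : V}
    (w : (avoid G B).Walk x y) (hx : x ∉ B) : ∀ q ∈ w.support, q ∉ B := by
  induction w with
  | nil => simpa using hx
  | cons h w ih =>
    intro q hq
    rw [SimpleGraph.Walk.support_cons, List.mem_cons] at hq
    rcases hq with rfl | hq
    · exact hx
    · exact ih h.2.2 q hq

/-- Removing `v` leaves the graph connected. -/
def NonCut (G : SimpleGraph V) (v : V) : Prop :=
  ∀ x y, x ≠ v → y ≠ v → (avoid G {v}).Reachable x y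

theorem exists_nonCut {G : SimpleGraph V} (hG : G.Connected) : ∃ v, NonCut G v := by
  have := hG.nonempty
  obtain ⟨v, hv⟩ := hG.exists_preconnected_induce_compl_singleton_of_finite
  refine ⟨v, fun x y hx hy => ?_⟩
  let f : G.induce {v}ᶜ →g avoid G {v} := ⟨Subtype.val, fun {a b} h => ⟨h, a.2, b.2⟩⟩
  exact (hv ⟨x, hx⟩ ⟨y, hy⟩).map f

/-- The vertices `x` and `y` outside `B` are joined by a path outside `B` and have distinct
neighbors in `B`. -/
def Ear (G : SimpleGraph V) (B : Set V) (x y : V) : Prop :=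
  x ∉ B ∧ y ∉ B ∧ (avoid G B).Reachable x y ∧
    ∃ h ∈ B, ∃ g ∈ B, h ≠ g ∧ G.Adj x h ∧ G.Adj y g

/-- A walk from `x` to `b` that avoids `v` enters `B` at a vertex other than `v`; its part before
the first entry is the ear. -/
theorem NonCut.exists_ear {G : SimpleGraph V} {B : Set V} {v x b : V} (hv : NonCut G v)
    (hvB : v ∈ B) (hx : x ∉ B) (hvx : G.Adj v x) (hb : b ∈ B) (hbv : b ≠ v) :
    ∃ x y, Ear G B x y := by
  obtain ⟨w⟩ := hv x b hvx.ne' hbv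
  obtain ⟨d, -, h1, h2⟩ := w.exists_boundary_dart
    {z | z ∉ B ∧ (avoid G B).Reachable x z} ⟨hx, SimpleGraph.Reachable.refl x⟩ (fun h => h.1 hb)
  have hadj : (avoid G {v}).Adj d.fst d.snd := d.adj
  have hmem : d.snd ∈ B := by
    by_contra hcon
    have : (avoid G B).Adj d.fst d.snd := ⟨hadj.1, h1.1, hcon⟩
    exact h2 ⟨hcon, h1.2.trans this.reachable⟩
  exact ⟨x, d.fst, hx, h1.1, h1.2, v, hvB, d.snd, hmem, fun e => hadj.2.2 e.symm, hvx.symm, hadj.1⟩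

/-- A shortest ear is a single vertex: a longer one would contradict `Alternating.no_ear` on an
alternating cycle through its two attachments. `B` will be a cycle or a clique. -/
theorem exists_two_adj_of_ear (hT : D.Tight L s) {B : Set V}
    (hB : ∀ h ∈ B, ∀ g ∈ B, h ≠ g → ∃ (n : ℕ) (p : ZMod n → V),
      IsInducedCycle D.toSimpleGraphInclusive n p ∧ D.Alternating L s p ∧ Set.range p ⊆ B ∧
        h ∈ Set.range p ∧ g ∈ Set.range p)
    (hear : ∃ x y, Ear D.toSimpleGraphInclusive B x y) :
    ∃ x ∉ B, ∃ h ∈ B, ∃ g ∈ B, h ≠ g ∧ D.toSimpleGraphInclusive.Adj x h ∧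
      D.toSimpleGraphInclusive.Adj x g := by
  set G := D.toSimpleGraphInclusive with hG
  have hex : ∃ d x y, Ear G B x y ∧ (avoid G B).dist x y = d := by
    obtain ⟨x, y, h⟩ := hear; exact ⟨_, x, y, h, rfl⟩
  obtain ⟨x, y, hxy, hd⟩ := Nat.find_spec hex
  have hmin : ∀ x' y', Ear G B x' y' → (avoid G B).dist x y ≤ (avoid G B).dist x' y' := by
    intro x' y' h; rw [hd]; exact Nat.find_min' hex ⟨x', y', h, rfl⟩
  obtain ⟨hx, hy, hr, h, hh, g, hg, hhg, hxh, hyg⟩ := hxy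
  by_cases h0 : (avoid G B).dist x y = 0
  · rw [hr.dist_eq_zero_iff] at h0
    subst h0
    exact ⟨x, hx, h, hh, g, hg, hhg, hxh, hyg⟩
  exfalso
  obtain ⟨w, hw⟩ := hr.exists_walk_length_eq_dist
  have hsupp := not_mem_of_mem_support w hx
  -- A third attachment at `q` would make both parts of the path ears, hence both at least as long
  -- as the whole path of positive length.
  have hnbr : ∀ q ∈ w.support, ∀ b ∈ B, G.Adj q b → b = h ∨ b = g := by
    intro q hq b hb hqb
    by_contra! hcon
    have h1 := hmin x q ⟨hx, hsupp q hq, ⟨w.takeUntil q hq⟩, h, hh, b, hb, hcon.1.symm, hxh, hqb⟩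
    have h2 := hmin q y ⟨hsupp q hq, hy, ⟨w.dropUntil q hq⟩, b, hb, g, hg, hcon.2, hqb, hyg⟩
    have h3 := SimpleGraph.dist_le (w.takeUntil q hq)
    have h4 := SimpleGraph.dist_le (w.dropUntil q hq)
    have h5 := congrArg SimpleGraph.Walk.length (w.take_spec hq)
    rw [SimpleGraph.Walk.length_append] at h5
    omega
  have hch : List.IsChain G.Adj (x :: w.support.tail) := by
    rw [SimpleGraph.Walk.cons_tail_support]
    exact w.isChain_adj_support.imp fun _ _ h => h.1
  have hnd : (x :: w.support.tail).Nodup := by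
    rw [SimpleGraph.Walk.cons_tail_support]
    exact (w.isPath_of_length_eq_dist hw).support_nodup
  have hlast : ∀ e ∈ (x :: w.support.tail).getLast?, G.Adj e g := by
    rw [SimpleGraph.Walk.cons_tail_support]
    intro e he
    rw [List.getLast?_eq_some_getLast (by simp), SimpleGraph.Walk.getLast_support,
      Option.mem_some_iff] at he
    exact he ▸ hyg
  have key : ∀ (n : ℕ) (p : ZMod n → V), IsInducedCycle G n p → D.Alternating L s p →
      Set.range p ⊆ B → ∀ j : ZMod n, p 1 = h → p j = g → j ≠ 0 → False := by
    intro n p hC hA hpB j h1 hj hj0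
    refine hA.no_ear hC hT hch hnd ?_ ?_ (h1 ▸ hxh.symm) hj0 (j := j) ?_ (hj ▸ hlast)
    · rw [SimpleGraph.Walk.cons_tail_support]
      exact fun q hq hqp => hsupp q hq (hpB hqp)
    · rw [SimpleGraph.Walk.cons_tail_support]
      intro q hq hadj
      rcases hnbr q hq (p 0) (hpB ⟨0, rfl⟩) hadj.symm with e | e
      · exact hC.one_ne_zero (hC.inj (h1.trans e.symm))
      · exact hj0 (hC.inj (hj.trans e.symm))
    · rintro rfl
      exact hhg (h1.symm.trans hj)
  obtain ⟨n, p, hC, hA, hpB, ⟨i, hi⟩, ⟨j, hj⟩⟩ := hB h hh g hg hhg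
  -- The cycle is re-indexed so that `h` becomes `p 1` and `g` is not `p 0`; when `g` precedes `h`,
  -- the orientation is reversed.
  by_cases hji : j = i - 1
  · refine key n _ (hC.shift (i + 1)).reverse ((hA.shift hC hT (i + 1)).reverse) ?_
      2 ?_ ?_ hC.two_ne_zero
    · rintro _ ⟨k, rfl⟩; exact hpB ⟨_, rfl⟩
    · rw [← hi]; congr 1; ring
    · rw [← hj, hji]; congr 1; ring
  · refine key n _ (hC.shift (i - 1)) (hA.shift hC hT (i - 1)) ?_ (j - (i - 1)) ?_ ?_ ?_
    · rintro _ ⟨k, rfl⟩; exact hpB ⟨_, rfl⟩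
    · rw [← hi]; congr 1; ring
    · rw [← hj]; congr 1; ring
    · exact sub_ne_zero.2 hji

/-! ### Finding an alternating induced cycle -/

theorem eq_add_one_iff_val {n : ℕ} (hn : 2 ≤ n) (i j : ZMod n) :
    j = i + 1 ↔ j.val = i.val + 1 ∨ (i.val = n - 1 ∧ j.val = 0) := by
  have : NeZero n := ⟨by omega⟩
  have : Fact (1 < n) := ⟨by omega⟩
  have hi := i.val_lt
  have hj := j.val_lt
  rw [← (ZMod.val_injective n).eq_iff, ZMod.val_add, ZMod.val_one]
  rcases Nat.lt_or_ge (i.val + 1) n with h | h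
  · rw [Nat.mod_eq_of_lt h]; omega
  · have : i.val + 1 = n := by omega
    rw [this, Nat.mod_self]; omega

theorem IsInducedCycle.of_nat {G : SimpleGraph V} {n : ℕ} {f : ℕ → V} (hn : 3 ≤ n)
    (hinj : ∀ a b, a < b → b < n → f a ≠ f b)
    (hadj : ∀ a b, a < b → b < n → (G.Adj (f a) (f b) ↔ b = a + 1 ∨ (a = 0 ∧ b = n - 1))) :
    IsInducedCycle G n fun i : ZMod n => f i.val where
  three_le := hn
  inj := fun i j h => by
    have : NeZero n := ⟨by omega⟩
    have hi := i.val_lt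
    have hj := j.val_lt
    apply ZMod.val_injective n
    rcases lt_trichotomy i.val j.val with hlt | heq | hlt
    · exact absurd h (hinj _ _ hlt hj)
    · exact heq
    · exact absurd h.symm (hinj _ _ hlt hi)
  adj_iff := fun i j => by
    have : NeZero n := ⟨by omega⟩
    have hi := i.val_lt
    have hj := j.val_lt
    rw [eq_add_one_iff_val (by omega), eq_add_one_iff_val (by omega)]
    rcases lt_trichotomy i.val j.val with hlt | heq | hlt
    · rw [hadj _ _ hlt hj]; omega
    · rw [heq]
      have := G.loopless.irrefl (f j.val)
      constructor
      · intro h; exact absurd h this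
      · omega
    · rw [G.adj_comm, hadj _ _ hlt hi]; omega

theorem val_one_of_three_le {n : ℕ} (hn : 3 ≤ n) : (1 : ZMod n).val = 1 := by
  have : Fact (1 < n) := ⟨by omega⟩
  exact ZMod.val_one n

theorem val_neg_one_of_three_le {n : ℕ} (hn : 3 ≤ n) : (-1 : ZMod n).val = n - 1 := by
  obtain ⟨m, rfl⟩ : ∃ m, n = m + 1 := ⟨n - 1, by omega⟩
  exact ZMod.val_neg_one m

/-- If a vertex `v` that does not separate the graph is uncolored and sees two colors, then it lies
on an alternating induced cycle. -/
theorem NonCut.exists_cycle {v x y : V}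
    (hv : NonCut D.toSimpleGraphInclusive v) {φ : V → α} (hφ : D.Conf L s v φ)
    (hx : D.toSimpleGraphInclusive.Adj v x) (hy : D.toSimpleGraphInclusive.Adj v y)
    (hxy : φ x ≠ φ y) : ∃ (n : ℕ) (p : ZMod n → V),
      IsInducedCycle D.toSimpleGraphInclusive n p ∧ p 0 = v ∧ D.Alternating L s p := by
  set G := D.toSimpleGraphInclusive with hG
  -- The differently colored neighbors are chosen at minimum distance after removal of `v`.
  have hex : ∃ d x y, (G.Adj v x ∧ G.Adj v y ∧ φ x ≠ φ y) ∧ (avoid G {v}).dist x y = d :=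
    ⟨_, x, y, ⟨hx, hy, hxy⟩, rfl⟩
  obtain ⟨x, y, ⟨hx, hy, hxy⟩, hd⟩ := Nat.find_spec hex
  have hmin : ∀ x' y', G.Adj v x' → G.Adj v y' → φ x' ≠ φ y' →
      (avoid G {v}).dist x y ≤ (avoid G {v}).dist x' y' := by
    intro x' y' h1 h2 h3; rw [hd]; exact Nat.find_min' hex ⟨x', y', ⟨h1, h2, h3⟩, rfl⟩
  clear hd
  have hr := hv x y hx.ne' hy.ne'
  have hpos : 0 < (avoid G {v}).dist x y := hr.pos_dist_of_ne (fun e => hxy (e ▸ rfl))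
  obtain ⟨w, hw⟩ := hr.exists_walk_length_eq_dist
  set t := w.length with ht
  have hsupp : ∀ i, w.getVert i ≠ v :=
    fun i => not_mem_of_mem_support w hx.ne' _ (w.getVert_mem_support i)
  have hl : ∀ i ≤ t, (avoid G {v}).dist x (w.getVert i) ≤ i := fun i hi => by
    refine (SimpleGraph.dist_le (w.take i)).trans ?_
    rw [SimpleGraph.Walk.take_length]; omega
  have hrr : ∀ i ≤ t, (avoid G {v}).dist (w.getVert i) y ≤ t - i := fun i hi => by
    refine (SimpleGraph.dist_le (w.drop i)).trans ?_
    rw [SimpleGraph.Walk.drop_length]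
  have hdist : ∀ i j, i < j → j ≤ t →
      j - i ≤ (avoid G {v}).dist (w.getVert i) (w.getVert j) := by
    intro i j hij hj
    have h1 := hl i (by omega)
    have h2 := hrr j hj
    have h3 := (hv x (w.getVert i) hx.ne' (hsupp i)).dist_triangle_left y
    have h4 := (hv (w.getVert i) (w.getVert j) (hsupp i) (hsupp j)).dist_triangle_left y
    omega
  -- An inner neighbor of `v` has a color different from that of `x` or of `y`, which would give a
  -- closer pair.
  have hvadj : ∀ i ≤ t, G.Adj v (w.getVert i) → i = 0 ∨ i = t := by
    intro i hi hadj
    by_cases hc : φ x = φ (w.getVert i)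
    · have := hmin _ _ hadj hy (hc ▸ hxy)
      have := hrr i hi
      omega
    · have := hmin _ _ hx hadj hc
      have := hl i hi
      omega
  let f : ℕ → V := fun | 0 => v | i + 1 => w.getVert i
  have hC : IsInducedCycle G (t + 2) fun i : ZMod (t + 2) => f i.val := by
    refine IsInducedCycle.of_nat (by omega) ?_ ?_
    · rintro (_ | a) (_ | b) hab hb
      · omega
      · exact (hsupp b).symm
      · omega
      · intro e
        have h1 := hdist a b (by omega) (by omega)
        change w.getVert a = w.getVert b at e
        rw [e, SimpleGraph.dist_self] at h1
        omega
    · rintro (_ | a) (_ | b) hab hb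
      · omega
      · change G.Adj v (w.getVert b) ↔ _
        constructor
        · intro h
          have := hvadj b (by omega) h
          omega
        · intro h
          have : b = 0 ∨ b = t := by omega
          rcases this with rfl | rfl
          · rwa [SimpleGraph.Walk.getVert_zero]
          · rwa [ht, SimpleGraph.Walk.getVert_length]
      · omega
      · change G.Adj (w.getVert a) (w.getVert b) ↔ _
        constructor
        · intro h
          have h1 := hdist a b (by omega) (by omega)
          have : (avoid G {v}).Adj (w.getVert a) (w.getVert b) := ⟨h, hsupp a, hsupp b⟩
          rw [SimpleGraph.dist_eq_one_iff_adj.2 this] at h1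
          omega
        · intro h
          have : b = a + 1 := by omega
          subst this
          exact (w.adj_getVert_succ (by omega)).1
  refine ⟨_, _, hC, by simp [f], φ, by simpa [f] using hφ, ?_⟩
  simp only [val_one_of_three_le hC.three_le, val_neg_one_of_three_le hC.three_le]
  change φ (w.getVert 0) ≠ φ (w.getVert t)
  rwa [SimpleGraph.Walk.getVert_zero, ht, SimpleGraph.Walk.getVert_length]

theorem eq_univ_of_closed {G : SimpleGraph V} (hG : G.Connected) {B : Set V} {v : V} (hv : v ∈ B)
    (hB : ∀ x ∈ B, ∀ y, G.Adj x y → y ∈ B) (u : V) : u ∈ B := by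
  by_contra hu
  obtain ⟨x, y, hx, hy, hxy⟩ := exists_adj_of_mem_not_mem hG (P := (· ∈ B)) hv hu
  exact hy (hB x hx y hxy)

/-! ### Alternating cycles longer than a triangle -/

section LongCycle

variable {n : ℕ} {p : ZMod n → V}

/-- Rotating around the triangle `p 0, p 1, x` gives `p 1` the color of `x` and fixes `p (-2)`,
which differs from `p 1` because `n > 3`. Both before and after, `p (-2)` and `p 1` have the same
color. -/
theorem IsInducedCycle.color_eq_of_adj (hC : IsInducedCycle D.toSimpleGraphInclusive n p)
    (hT : D.Tight L s) (hn : 3 < n) {φ : V → α} (h : D.Conf L s (p 0) φ) {x : V}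
    (hx : x ∉ Set.range p) (h0 : D.toSimpleGraphInclusive.Adj x (p 0))
    (h1 : D.toSimpleGraphInclusive.Adj x (p 1)) : φ x = φ (p 1) := by
  have h01 := hC.adj_succ 0
  rw [zero_add] at h01
  have hx' : ∀ i, p i ≠ x := fun i e => hx ⟨i, e⟩
  obtain ⟨-, -, ψ, h2, h3, -, h5⟩ := h.rotate hT (x := p 1) (y := x) (z := x) (l := [])
    (by simp [h01, h1.symm]) (by simp [hx', h01.ne]) (by simp) h0 (by simp)
  have e1 := (hC.reverse.rotate hT (by simpa using h)).1
  have e2 := (hC.reverse.rotate hT (by simpa using h2)).1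
  have h30 : (3 : ZMod n) ≠ 0 := by
    simpa using hC.natCast_ne_zero (i := 3) (by omega) (by omega)
  rw [h5] at e2
  · rw [neg_neg] at e1 e2
    rw [← h3, ← e2, e1]
  · have a1 : p (-2) ≠ p 0 := hC.inj.ne (neg_ne_zero.2 hC.two_ne_zero)
    have a2 : p (-2) ≠ p 1 := hC.inj.ne fun e => h30 (by linear_combination -e)
    simp [a1, a2, hx']

/-- By the previous lemma in both orientations, `x` would share its color with both `p 1` and `p
(-1)`. -/
theorem Alternating.not_adj_all (hA : D.Alternating L s p)
    (hC : IsInducedCycle D.toSimpleGraphInclusive n p) (hT : D.Tight L s) (hn : 3 < n) {x : V}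
    (hx : x ∉ Set.range p) (hadj : ∀ k, D.toSimpleGraphInclusive.Adj x (p k)) : False := by
  obtain ⟨φ, h1, h2⟩ := hA
  refine h2 ((hC.color_eq_of_adj hT hn h1 hx (hadj _) (hadj _)).symm.trans ?_)
  refine hC.reverse.color_eq_of_adj hT hn (by simpa using h1) ?_ (hadj _) (hadj _)
  rintro ⟨i, rfl⟩
  exact hx ⟨_, rfl⟩

theorem Alternating.adj_mem_range (hA : D.Alternating L s p)
    (hC : IsInducedCycle D.toSimpleGraphInclusive n p) (hT : D.Tight L s) (hn : 3 < n)
    (hv : NonCut D.toSimpleGraphInclusive (p 0)) {x : V}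
    (hx : D.toSimpleGraphInclusive.Adj (p 0) x) : x ∈ Set.range p := by
  by_contra hcon
  obtain ⟨y, hy, _, ⟨i, rfl⟩, _, ⟨j, rfl⟩, hij, hyi, hyj⟩ := exists_two_adj_of_ear hT
    (B := Set.range p) (fun h hh g hg _ => ⟨n, p, hC, hA, le_rfl, hh, hg⟩)
    (hv.exists_ear ⟨0, rfl⟩ hcon hx ⟨1, rfl⟩ (hC.inj.ne hC.one_ne_zero))
  exact hA.not_adj_all hC hT hn hy
    (hA.adj_all hC hT hy (fun e => hij (congrArg p e)) hyi hyj)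

theorem IsInducedCycle.card_pair (hC : IsInducedCycle D.toSimpleGraphInclusive n p) (i : ZMod n) :
    #{p (i + 1), p (i - 1)} = 2 :=
  Finset.card_pair (hC.inj.ne fun e => hC.two_ne_zero (by linear_combination (e : i + 1 = i - 1)))

theorem Alternating.adj_pair (hA : D.Alternating L s p)
    (hC : IsInducedCycle D.toSimpleGraphInclusive n p) (hT : D.Tight L s) (i : ZMod n) :
    ({p (i + 1), p (i - 1)} : Finset V) ⊆ ({w | D.Adj (p i) w} : Finset V) ∧
      ({p (i + 1), p (i - 1)} : Finset V) ⊆ ({w | D.Adj w (p i)} : Finset V) := by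
  have h1 := hA.bidirected hC hT i
  have h2 := hA.bidirected hC hT (i - 1)
  rw [sub_add_cancel] at h2
  simp [insert_subset_iff, h1, h2]

/-- If the induced alternating cycle is not a triangle, then it is the whole digraph. -/
theorem Alternating.isBidirectedOddCycle (hA : D.Alternating L s p)
    (hC : IsInducedCycle D.toSimpleGraphInclusive n p) (hT : D.Tight L s) (hn : 3 < n)
    (hv : NonCut D.toSimpleGraphInclusive (p 0)) {k : ℕ} (hk : ∀ v, #(L v) = k) :
    D.IsBidirectedOddCycle ∧ s = 1 ∧
      ∀ u w, D.toSimpleGraphInclusive.Adj u w → L u ⊆ L w := by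
  have hconf : ∀ i, ∃ φ, D.Conf L s (p i) φ ∧ φ (p (i + 1)) ≠ φ (p (i - 1)) := fun i => by
    obtain ⟨φ, h1, h2⟩ := hA.shift hC hT i
    simp only [zero_add] at h1
    exact ⟨φ, h1, by simpa only [add_comm 1 i, neg_add_eq_sub] using h2⟩
  have h2k : 2 ≤ k := by
    obtain ⟨φ, h1, h2⟩ := hconf 0
    rw [← hk (p 0), ← card_pair h2]
    exact card_le_card (by simp [insert_subset_iff, h1.mem_list hT (hC.adj_succ 0),
      h1.mem_list hT (hC.adj_pred 0), -zero_add, -zero_sub])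
  have hdeg : ∀ i, #{w | D.Adj (p i) w} = s * k ∧ #{w | D.Adj w (p i)} = s * k := fun i => by
    obtain ⟨φ, h1, -⟩ := hconf i
    rw [← hk (p i)]
    exact ⟨(h1.out_spec hT).1, (h1.in_spec hT).1⟩
  -- All neighbors of `p 0` lie on the induced cycle, so its degree `s * k` is at most two.
  have hsk : s * k = 2 := by
    have h2 : 2 ≤ s * k := le_trans h2k (Nat.le_mul_of_pos_left k hT.pos)
    refine le_antisymm ?_ h2
    rw [← (hdeg 0).1, ← hC.card_pair 0]
    refine card_le_card fun w hw => ?_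
    have hadj : D.toSimpleGraphInclusive.Adj (p 0) w :=
      hT.adj_iff.2 (Or.inl (by simpa using hw))
    obtain ⟨j, rfl⟩ := hA.adj_mem_range hC hT hn hv hadj
    rcases (hC.adj_iff _ _).1 hadj with h | h
    · simp [h]
    · simp [eq_sub_of_add_eq h.symm]
  have hs1 : s = 1 := by
    have := hT.pos
    nlinarith
  have hnbr : ∀ i w, D.toSimpleGraphInclusive.Adj (p i) w → w = p (i + 1) ∨ w = p (i - 1) := by
    intro i w hw
    rcases adj_or_adj_of_adj hw with h | h
    · have := eq_of_subset_of_card_le (hA.adj_pair hC hT i).1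
        (by rw [(hdeg i).1, hsk, hC.card_pair])
      simpa [← this] using (show w ∈ ({w | D.Adj (p i) w} : Finset V) by simpa using h)
    · have := eq_of_subset_of_card_le (hA.adj_pair hC hT i).2
        (by rw [(hdeg i).2, hsk, hC.card_pair])
      simpa [← this] using (show w ∈ ({w | D.Adj w (p i)} : Finset V) by simpa using h)
  have hsurj : ∀ u, u ∈ Set.range p := by
    refine eq_univ_of_closed hT.connected ⟨0, rfl⟩ ?_
    rintro _ ⟨i, rfl⟩ w hw
    rcases hnbr i w hw with rfl | rfl <;> exact ⟨_, rfl⟩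
  refine ⟨⟨D.toSimpleGraphInclusive, n, ?_, by omega, hA.odd hC hT, ?_⟩, hs1, ?_⟩
  · refine Digraph.ext ?_
    funext u w
    obtain ⟨i, rfl⟩ := hsurj u
    refine propext ⟨fun h => hT.adj_iff.2 (Or.inl h), fun h => ?_⟩
    rcases hnbr i w h with rfl | rfl
    · exact (hA.bidirected hC hT i).1
    · simpa using (hA.bidirected hC hT (i - 1)).2
  · obtain ⟨m, rfl⟩ : ∃ m, n = m + 2 := ⟨n - 2, by omega⟩
    let e : ZMod (m + 2) ≃ V := Equiv.ofBijective p ⟨hC.inj, hsurj⟩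
    refine ⟨RelIso.symm ⟨(show Fin (m + 2) ≃ V from e), fun {i j} => ?_⟩⟩
    rw [SimpleGraph.cycleGraph_adj]
    refine (hC.adj_iff i j).trans ?_
    rw [or_comm]
    exact or_congr sub_eq_iff_eq_add'.symm sub_eq_iff_eq_add'.symm
  -- The color `c` appears at a neighbor of `u`; if not at `w`, rotation carries it to `w`, where it
  -- must belong to the list.
  · intro u w huw c hc
    obtain ⟨i, rfl⟩ := hsurj u
    obtain ⟨φ, h1, -⟩ := hconf i
    obtain ⟨x, hx, rfl⟩ := h1.exists_adj_color hT hc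
    by_cases hxw : x = w
    · exact hxw ▸ h1.mem_list_self hx.ne'
    · obtain ⟨-, -, ψ, h2, h3, h4, -⟩ := (hC.shift i).rotate hT (by simpa using h1)
      simp only [zero_add, add_comm 1 i, neg_add_eq_sub] at h2 h3 h4
      have := h2.mem_list_self huw.ne'
      rcases hnbr i w huw with rfl | rfl <;> rcases hnbr i x hx with rfl | rfl
      · exact absurd rfl hxw
      · rwa [h3] at this
      · rwa [h4] at this
      · exact absurd rfl hxw

end LongCycle

/-! ### Alternating triangles and cliques -/

section Clique

/-- The closed walk `a, b, c` of length three. -/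
def triangle (a b c : V) (i : ZMod 3) : V :=
  match i.val with
  | 0 => a
  | 1 => b
  | _ => c

theorem isInducedCycle_triangle {G : SimpleGraph V} {a b c : V} (hab : G.Adj a b)
    (hbc : G.Adj b c) (hac : G.Adj a c) : IsInducedCycle G 3 (triangle a b c) := by
  refine IsInducedCycle.of_nat (f := fun i => match i with | 0 => a | 1 => b | _ => c) le_rfl ?_ ?_
  · intro i j hij hj
    interval_cases j <;> interval_cases i
    · exact hab.ne
    · exact hac.ne
    · exact hbc.ne
  · intro i j hij hj
    interval_cases j <;> interval_cases i
    · simpa using hab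
    · simpa using hac
    · simpa using hbc

theorem range_triangle (a b c : V) : Set.range (triangle a b c) = {a, b, c} := by
  ext x
  constructor
  · rintro ⟨i, rfl⟩
    fin_cases i
    · exact Or.inl rfl
    · exact Or.inr (Or.inl rfl)
    · exact Or.inr (Or.inr rfl)
  · rintro (rfl | rfl | rfl)
    · exact ⟨0, rfl⟩
    · exact ⟨1, rfl⟩
    · exact ⟨2, rfl⟩

/-- The colors of two adjacent neighbors of the uncolored vertex may be exchanged. -/
theorem Conf.swap (hT : D.Tight L s) {a b c : V} {φ : V → α} (h : D.Conf L s a φ)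
    (hab : D.toSimpleGraphInclusive.Adj a b) (hbc : D.toSimpleGraphInclusive.Adj b c)
    (hac : D.toSimpleGraphInclusive.Adj a c) :
    ∃ ψ, D.Conf L s a ψ ∧ ψ b = φ c ∧ ψ c = φ b ∧ ∀ w, w ≠ a → w ≠ b → w ≠ c → ψ w = φ w := by
  obtain ⟨-, -, ψ, h1, h2, h3, h4⟩ := h.rotate hT (x := b) (y := c) (z := c) (l := [])
    (by simp [hab, hbc]) (by simp [hab.ne, hac.ne, hbc.ne]) (by simp) hac.symm (by simp)
  exact ⟨ψ, h1, h2, h3, fun w ha hb hc => h4 w (by simp [ha, hb, hc])⟩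

/-- `K` is a clique containing `v`, and some coloring of all vertices but `v` uses two colors
on `K`. -/
def ColorfulClique (D : Digraph V) (L : V → Finset α) (s : ℕ) (v : V) (K : Finset V) : Prop :=
  v ∈ K ∧ (∀ a ∈ K, ∀ b ∈ K, a ≠ b → D.toSimpleGraphInclusive.Adj a b) ∧
    ∃ φ, D.Conf L s v φ ∧ ∃ x ∈ K, ∃ y ∈ K, x ≠ v ∧ y ≠ v ∧ φ x ≠ φ y

variable {v : V} {K : Finset V}

/-- When the hole moves inside `K`, the colors on the rest of `K` are only permuted. -/
theorem ColorfulClique.change (hT : D.Tight L s) (hK : D.ColorfulClique L s v K) {a : V}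
    (ha : a ∈ K) : D.ColorfulClique L s a K := by
  obtain ⟨hv, hcl, φ, hφ, x, hx, y, hy, hxv, hyv, hxy⟩ := hK
  refine ⟨ha, hcl, ?_⟩
  by_cases hav : a = v
  · subst hav; exact ⟨φ, hφ, x, hx, y, hy, hxv, hyv, hxy⟩
  refine ⟨_, hφ.shift hT (hcl v hv a ha (Ne.symm hav)), ?_⟩
  by_cases hax : a = x
  · subst hax
    exact ⟨v, hv, y, hy, hxv.symm, fun e => hxy (e ▸ rfl),
      by rwa [update_self, update_of_ne hyv]⟩
  by_cases hay : a = y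
  · subst hay
    exact ⟨x, hx, v, hv, Ne.symm hax, hyv.symm, by rwa [update_self, update_of_ne hxv]⟩
  exact ⟨x, hx, y, hy, Ne.symm hax, Ne.symm hay,
    by rwa [update_of_ne hxv, update_of_ne hyv]⟩

/-- If `b` and `c` have the same color, exchange that of `b` with another color present in `K`. -/
theorem ColorfulClique.alternating (hT : D.Tight L s) (hK : D.ColorfulClique L s v K) {a b c : V}
    (ha : a ∈ K) (hb : b ∈ K) (hc : c ∈ K) (hab : a ≠ b) (hac : a ≠ c) (hbc : b ≠ c) :
    D.Alternating L s (triangle a b c) := by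
  obtain ⟨-, hcl, φ, hφ, x, hx, y, hy, hxv, hyv, hxy⟩ := hK.change hT ha
  by_cases h : φ b = φ c
  · obtain ⟨z, hz, hza, hzb⟩ : ∃ z ∈ K, z ≠ a ∧ φ z ≠ φ b := by
      by_cases hxb : φ x = φ b
      · exact ⟨y, hy, hyv, fun e => hxy (hxb.trans e.symm)⟩
      · exact ⟨x, hx, hxv, hxb⟩
    have hzb' : b ≠ z := fun e => hzb (e ▸ rfl)
    have hzc' : c ≠ z := fun e => hzb (e ▸ h.symm)
    obtain ⟨ψ, h1, h2, -, h4⟩ := hφ.swap hT (hcl a ha b hb hab) (hcl b hb z hz hzb')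
      (hcl a ha z hz hza.symm)
    refine ⟨ψ, h1, ?_⟩
    change ψ b ≠ ψ c
    rw [h2, h4 c hac.symm hbc.symm hzc', ← h]
    exact hzb
  · exact ⟨φ, hφ, h⟩

theorem ColorfulClique.exists_third (hK : D.ColorfulClique L s v K) (a b : V) :
    ∃ c ∈ K, a ≠ c ∧ b ≠ c := by
  obtain ⟨hv, -, φ, -, x, hx, y, hy, hxv, hyv, hxy⟩ := hK
  have hxy' : x ≠ y := fun e => hxy (e ▸ rfl)
  by_cases h1 : a ≠ v ∧ b ≠ v
  · exact ⟨v, hv, h1⟩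
  by_cases h2 : a ≠ x ∧ b ≠ x
  · exact ⟨x, hx, h2⟩
  refine ⟨y, hy, ?_, ?_⟩ <;> · rintro rfl; grind

theorem ColorfulClique.bidirected (hT : D.Tight L s) (hK : D.ColorfulClique L s v K) {a b : V}
    (ha : a ∈ K) (hb : b ∈ K) (hab : a ≠ b) : D.Adj a b ∧ D.Adj b a := by
  obtain ⟨c, hc, hac, hbc⟩ := hK.exists_third a b
  exact (hK.alternating hT ha hb hc hab hac hbc).bidirected
    (isInducedCycle_triangle (hK.2.1 a ha b hb hab) (hK.2.1 b hb c hc hbc)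
      (hK.2.1 a ha c hc hac)) hT 0

/-- Any two vertices of `K` lie on an alternating triangle in `K`, so some outside vertex `y` has
two neighbors in `K`. By the triangles through these two, `y` sees all of `K`. -/
theorem ColorfulClique.exists_insert (hT : D.Tight L s) (hK : D.ColorfulClique L s v K)
    (hv : NonCut D.toSimpleGraphInclusive v) {x : V} (hx : D.toSimpleGraphInclusive.Adj v x)
    (hxK : x ∉ K) : ∃ y ∉ K, D.ColorfulClique L s v (Insert.insert y K) := by
  have htri : ∀ {a b c}, a ∈ K → b ∈ K → c ∈ K → a ≠ b → a ≠ c → b ≠ c →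
      IsInducedCycle D.toSimpleGraphInclusive 3 (triangle a b c) := fun ha hb hc hab hac hbc =>
    isInducedCycle_triangle (hK.2.1 _ ha _ hb hab) (hK.2.1 _ hb _ hc hbc) (hK.2.1 _ ha _ hc hac)
  have hrange : ∀ {a b c}, a ∈ K → b ∈ K → c ∈ K → Set.range (triangle a b c) ⊆ (K : Set V) := by
    intro a b c ha hb hc
    rw [range_triangle]
    rintro _ (rfl | rfl | rfl) <;> assumption
  obtain ⟨b, hb, hvb, -⟩ := hK.exists_third v v
  obtain ⟨y, hy, h, hh, g, hg, hhg, hyh, hyg⟩ := exists_two_adj_of_ear hT (B := (K : Set V))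
    (fun h hh g hg hhg => by
      obtain ⟨a, ha, hha, hga⟩ := hK.exists_third h g
      exact ⟨3, triangle h g a, htri hh hg ha hhg hha hga, hK.alternating hT hh hg ha hhg hha hga,
        hrange hh hg ha, ⟨0, rfl⟩, ⟨1, rfl⟩⟩)
    (hv.exists_ear hK.1 hxK hx hb hvb.symm)
  have hyK : ∀ a ∈ K, D.toSimpleGraphInclusive.Adj y a := by
    intro a ha
    by_cases hha : h = a
    · exact hha ▸ hyh
    by_cases hga : g = a
    · exact hga ▸ hyg
    exact (hK.alternating hT hh hg ha hhg hha hga).adj_all (htri hh hg ha hhg hha hga) hT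
      (fun e => hy (hrange hh hg ha e)) (i := 0) (j := 1) (by decide) hyh hyg 2
  obtain ⟨hvK, hcl, φ, hφ, x, hx, z, hz, h⟩ := hK
  refine ⟨y, hy, mem_insert_of_mem hvK, fun a ha b hb hab => ?_, φ, hφ, x, mem_insert_of_mem hx,
    z, mem_insert_of_mem hz, h⟩
  rcases mem_insert.1 ha with ha' | ha' <;> rcases mem_insert.1 hb with hb' | hb'
  · exact absurd (ha'.trans hb'.symm) hab
  · exact ha' ▸ hyK b hb'
  · exact hb' ▸ (hyK a ha').symm
  · exact hcl a ha' b hb' hab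

/-- If the uncolored vertex lies in a clique with two colors, the digraph is complete. -/
theorem ColorfulClique.isBidirectedComplete (hT : D.Tight L s) (hK : D.ColorfulClique L s v K)
    (hv : NonCut D.toSimpleGraphInclusive v) {k : ℕ} (hk : ∀ v, #(L v) = k) :
    D.IsBidirectedComplete ∧ Fintype.card V - 1 ≡ 0 [MOD s] ∧
      ∀ u w, D.toSimpleGraphInclusive.Adj u w → L u ⊆ L w := by
  obtain ⟨K, hK', hmax⟩ := exists_max_image {K | D.ColorfulClique L s v K} card ⟨K, by simpa⟩
  clear hK
  simp only [mem_filter, mem_univ, true_and] at hK' hmax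
  have hK := hK'
  have hnbr : ∀ x, D.toSimpleGraphInclusive.Adj v x → x ∈ K := by
    intro x hx
    by_contra hxK
    obtain ⟨y, hy, hK2⟩ := hK.exists_insert hT hv hx hxK
    have := hmax _ hK2
    rw [card_insert_of_notMem hy] at this
    omega
  have hsub : ∀ u ∈ K, K.erase u ⊆ ({w | D.Adj u w} : Finset V) ∧
      K.erase u ⊆ ({w | D.Adj w u} : Finset V) := fun u hu =>
    ⟨fun w hw => by
      simpa using (hK.bidirected hT hu (mem_of_mem_erase hw) (ne_of_mem_erase hw).symm).1,
    fun w hw => by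
      simpa using (hK.bidirected hT hu (mem_of_mem_erase hw) (ne_of_mem_erase hw).symm).2⟩
  have hdeg : ∀ u ∈ K, #{w | D.Adj u w} = s * k ∧ #{w | D.Adj w u} = s * k := fun u hu => by
    obtain ⟨-, -, φ, h1, -⟩ := hK.change hT hu
    rw [← hk u]
    exact ⟨(h1.out_spec hT).1, (h1.in_spec hT).1⟩
  have hcard : #K - 1 = s * k := by
    rw [← (hdeg v hK.1).1, ← card_erase_of_mem hK.1]
    congr 1
    refine (hsub v hK.1).1.antisymm fun w hw => ?_
    have hadj : D.toSimpleGraphInclusive.Adj v w := hT.adj_iff.2 (Or.inl (by simpa using hw))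
    exact mem_erase.2 ⟨hadj.ne', hnbr w hadj⟩
  -- Each vertex of `K` already has all its `s * k` out- and in-neighbors inside `K`, so no edge
  -- leaves `K`.
  have hall : ∀ u, u ∈ K := by
    refine eq_univ_of_closed hT.connected (B := (K : Set V)) hK.1 fun u hu w hw => ?_
    refine mem_of_mem_erase (a := u) ?_
    rcases adj_or_adj_of_adj hw with h | h
    · rw [eq_of_subset_of_card_le (hsub u hu).1
        (by rw [(hdeg u hu).1, card_erase_of_mem hu, hcard])]
      simpa using h
    · rw [eq_of_subset_of_card_le (hsub u hu).2
        (by rw [(hdeg u hu).2, card_erase_of_mem hu, hcard])]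
      simpa using h
  refine ⟨?_, ?_, ?_⟩
  · refine Digraph.ext ?_
    funext u w
    refine propext ⟨fun h => (hT.adj_iff.2 (Or.inl h)).ne,
      fun h => (hK.bidirected hT (hall u) (hall w) h).1⟩
  · have : Fintype.card V = #K := by rw [← card_univ, eq_univ_iff_forall.2 hall]
    rw [this, hcard]
    exact (Nat.modEq_zero_iff_dvd).2 (dvd_mul_right _ _)
  · intro u w huw c hc
    obtain ⟨-, hcl, φ, h1, -⟩ := hK.change hT (hall u)
    obtain ⟨x, hx, rfl⟩ := h1.exists_adj_color hT hc
    by_cases hxw : x = w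
    · exact hxw ▸ h1.mem_list_self hx.ne'
    · obtain ⟨ψ, h2, h3, -⟩ := h1.swap hT huw (hcl w (hall w) x (hall x) (Ne.symm hxw)) hx
      exact h3 ▸ h2.mem_list_self huw.ne'

end Clique

/-! ### The exceptional digraphs are not colorable -/

theorem outDeg_le_maxDeg (D : Digraph V) (v : V) : D.outDeg v ≤ D.maxDeg :=
  (le_max_left _ _).trans (le_sup (f := fun v => max (D.outDeg v) (D.inDeg v)) (mem_univ v))

theorem inDeg_le_maxDeg (D : Digraph V) (v : V) : D.inDeg v ≤ D.maxDeg :=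
  (le_max_right _ _).trans (le_sup (f := fun v => max (D.outDeg v) (D.inDeg v)) (mem_univ v))

theorem maxDeg_eq_of_regular [Nonempty V] {d : ℕ}
    (h : ∀ v, D.outDeg v = d ∧ D.inDeg v = d) : D.maxDeg = d := by
  obtain ⟨v⟩ := ‹Nonempty V›
  refine le_antisymm (Finset.sup_le fun v _ => ?_) ((h v).1 ▸ D.outDeg_le_maxDeg v)
  rw [(h v).1, (h v).2, max_self]

/-- Monochromatic sets in which all degrees are at least `s` obstruct colorings. -/
theorem PartialColoring.false_of_le {φ : V → α} (h : D.PartialColoring L s univ φ) {Y : Finset V}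
    (hY : Y.Nonempty) {a : α} (ha : ∀ y ∈ Y, φ y = a)
    (hdeg : ∀ y ∈ Y, s ≤ #{w ∈ Y | D.Adj y w} ∧ s ≤ #{w ∈ Y | D.Adj w y}) : False := by
  obtain ⟨y, hy, hlt⟩ := h.2 a Y (subset_univ _) hY ha
  have := hdeg y hy
  omega

theorem not_isListColorable_of_complete [Nonempty V] (hD : D.IsBidirectedComplete)
    {Γ : Finset α} (hΓ : ∀ v, L v = Γ) (hcard : s * #Γ = D.maxDeg) :
    ¬ D.IsListColorable L s := by
  intro hcol
  obtain ⟨φ, hφ⟩ := hcol.exists_coloring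
  have hadj : ∀ u v, D.Adj u v ↔ u ≠ v := fun u v => by rw [hD]; exact Iff.rfl
  have hmax : D.maxDeg = Fintype.card V - 1 := maxDeg_eq_of_regular fun v => by
    rw [outDeg_eq_card, inDeg_eq_card]
    simp only [hadj]
    rw [filter_ne, filter_ne', card_erase_of_mem (mem_univ v), card_univ]
    exact ⟨rfl, rfl⟩
  have hpos := Fintype.card_pos (α := V)
  -- There are `s * #Γ + 1` vertices, so some color class has more than `s` of them.
  obtain ⟨c, -, hc⟩ := exists_lt_card_fiber_of_mul_lt_card_of_maps_to (s := univ) (t := Γ)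
    (f := φ) (n := s) (fun v _ => hΓ v ▸ hφ.1 v (mem_univ v))
    (by rw [mul_comm, hcard, hmax, card_univ]; omega)
  refine hφ.false_of_le (Y := {x | φ x = c}) (card_pos.1 (by omega)) (a := c) (by simp) ?_
  intro y hy
  simp only [hadj]
  rw [filter_ne, filter_ne', card_erase_of_mem hy]
  omega

theorem not_isListColorable_of_oddCycle (hD : D.IsBidirectedOddCycle)
    {Γ : Finset α} (hΓ : ∀ v, L v = Γ) (hcard : #Γ = D.maxDeg) :
    ¬ D.IsListColorable L 1 := by
  intro hcol
  obtain ⟨φ, hφ⟩ := hcol.exists_coloring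
  obtain ⟨G, n, hG, hn, hodd, ⟨e⟩⟩ := hD
  have hadj : ∀ u v, D.Adj u v ↔ G.Adj u v := fun u v => by rw [hG]; exact Iff.rfl
  obtain ⟨m, rfl⟩ : ∃ m, n = m + 3 := ⟨n - 3, by omega⟩
  have : Nonempty V := ⟨e.symm 0⟩
  have hdeg : ∀ v, #{w | G.Adj v w} = 2 := fun v => by
    rw [← G.neighborFinset_eq_filter, G.card_neighborFinset_eq_degree, ← e.degree_eq]
    convert SimpleGraph.cycleGraph_degree_three_le (n := m) (v := e v)
  have hmax : D.maxDeg = 2 := maxDeg_eq_of_regular fun v => by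
    rw [outDeg_eq_card, inDeg_eq_card]
    simp only [hadj, G.adj_comm _ v, hdeg, and_self]
  -- Two adjacent vertices of one color span a digon with all degrees `1 = s`, so the coloring is
  -- proper and uses at most two colors on an odd cycle.
  have hcoloring : ∀ u v, G.Adj u v → φ u ≠ φ v := by
    intro u v huv he
    refine hφ.false_of_le (Y := {u, v}) (a := φ v) (by simp) (by simp [he]) ?_
    intro y hy
    rw [Nat.one_le_iff_ne_zero, Nat.one_le_iff_ne_zero, ← Nat.pos_iff_ne_zero,
      ← Nat.pos_iff_ne_zero, card_pos, card_pos]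
    simp only [hadj]
    rcases (by simpa using hy : y = u ∨ y = v) with rfl | rfl
    · exact ⟨⟨v, by simp [huv]⟩, ⟨v, by simp [huv.symm]⟩⟩
    · exact ⟨⟨u, by simp [huv.symm]⟩, ⟨u, by simp [huv]⟩⟩
  let C : (SimpleGraph.cycleGraph (m + 3)).Coloring Γ := SimpleGraph.Coloring.mk
    (fun i => ⟨φ (e.symm i), hΓ (e.symm i) ▸ hφ.1 _ (mem_univ _)⟩) fun {i j} hij h =>
      hcoloring _ _ (e.symm.map_adj_iff.2 hij) (congrArg Subtype.val h)
  have h2 := C.colorable.chromaticNumber_le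
  rw [SimpleGraph.chromaticNumber_cycleGraph_of_odd _ (by omega) hodd, Fintype.card_coe, hcard,
    hmax] at h2
  norm_num at h2

theorem not_isListColorable_of_regular [Nonempty V] (hD : ∀ v, D.inDeg v = s ∧ D.outDeg v = s)
    {Γ : Finset α} (hΓ : ∀ v, L v = Γ) (hcard : #Γ ≤ 1) : ¬ D.IsListColorable L s := by
  intro hcol
  obtain ⟨φ, hφ⟩ := hcol.exists_coloring
  obtain ⟨v⟩ := ‹Nonempty V›
  refine hφ.false_of_le (Y := univ) ⟨v, mem_univ v⟩ (a := φ v) (fun y _ => ?_) fun y _ => ?_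
  · exact card_le_one.1 hcard _ (hΓ y ▸ hφ.1 y (mem_univ y)) _ (hΓ v ▸ hφ.1 v (mem_univ v))
  · rw [← outDeg_eq_card, ← inDeg_eq_card, (hD y).1, (hD y).2]
    exact ⟨le_rfl, le_rfl⟩

/-! ### Assembling the characterization -/

theorem Tight.list_eq_of_subset (hT : D.Tight L s) {k : ℕ} (hk : ∀ v, #(L v) = k)
    (h : ∀ u w, D.toSimpleGraphInclusive.Adj u w → L u ⊆ L w) (u w : V) : L w = L u := by
  have := eq_univ_of_closed hT.connected (B := {w | L w = L u}) (v := u) rfl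
    (fun x hx y hxy => ?_) w
  · exact this
  · change L y = L u
    change L x = L u at hx
    rw [← hx]
    exact (eq_of_subset_of_card_le (h x y hxy) (by rw [hk, hk])).symm

theorem Tight.exists_conf (hT : D.Tight L s) (hne : ∀ v, (L v).Nonempty) (v : V) :
    ∃ φ, D.Conf L s v φ :=
  hT.exists_partialColoring ⟨fun v => (hne v).choose⟩ _ (erase_ssubset (mem_univ v)).ne

/-- A one-vertex digraph is colorable as soon as its list is not empty. -/
theorem Tight.list_eq_empty [Subsingleton V] (hT : D.Tight L s) (v : V) : L v = ∅ := by
  by_contra hne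
  obtain ⟨c, hc⟩ := nonempty_iff_ne_empty.2 hne
  have hadj : ∀ u w, ¬ D.Adj u w := fun u w h => hT.loopless u (by rwa [Subsingleton.elim w u] at h)
  refine hT.not_colorable (fun _ => c) ⟨fun u _ => Subsingleton.elim v u ▸ hc, ?_⟩
  rintro a Y - ⟨y, hy⟩ -
  exact ⟨y, hy, Or.inl (by simp only [hadj, filter_false, card_empty]; exact hT.pos)⟩

theorem Tight.list_nonempty [Nontrivial V] (hT : D.Tight L s) (v : V) : (L v).Nonempty := by
  obtain ⟨w, hw⟩ := hT.connected.preconnected.exists_adj_of_nontrivial v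
  rw [← card_pos]
  refine Nat.pos_of_mul_pos_left (a := s) ?_
  rcases adj_or_adj_of_adj hw with h | h
  · exact (card_pos.2 ⟨w, by simpa using h⟩).trans_le (hT.out_le v)
  · exact (card_pos.2 ⟨w, by simpa using h⟩).trans_le (hT.in_le v)

/-- The structure of tight digraphs all of whose lists have `k` elements, where `k` is positive. -/
theorem Tight.structure (hT : D.Tight L s) {k : ℕ} (hk : ∀ v, #(L v) = k) (hpos : 0 < k) :
    ((D.IsBidirectedComplete ∧ Fintype.card V - 1 ≡ 0 [MOD s]) ∨
      (D.IsBidirectedOddCycle ∧ s = 1) ∨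
      (D.IsEulerian ∧ ∀ v, D.inDeg v = s ∧ D.outDeg v = s)) ∧
      ∀ u w, D.toSimpleGraphInclusive.Adj u w → L u ⊆ L w := by
  have hne : ∀ v, (L v).Nonempty := fun v => card_pos.1 (by rw [hk]; exact hpos)
  have hconf := hT.exists_conf hne
  obtain rfl | h2 : k = 1 ∨ 2 ≤ k := by omega
  · refine ⟨Or.inr (Or.inr ?_), fun u w huw => ?_⟩
    · have hdeg : ∀ v, D.inDeg v = s ∧ D.outDeg v = s := fun v => by
        obtain ⟨φ, hφ⟩ := hconf v
        rw [outDeg_eq_card, inDeg_eq_card, (hφ.out_spec hT).1, (hφ.in_spec hT).1, hk, mul_one]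
        exact ⟨rfl, rfl⟩
      exact ⟨fun v => (hdeg v).2.trans (hdeg v).1.symm, hdeg⟩
    · obtain ⟨φ, hφ⟩ := hconf u
      intro c hc
      rw [card_le_one.1 (hk u).le c hc _ (hφ.mem_list hT huw)]
      exact hφ.mem_list_self huw.ne'
  · obtain ⟨v, hv⟩ := exists_nonCut hT.connected
    obtain ⟨φ, hφ⟩ := hconf v
    obtain ⟨a, ha, b, hb, hab⟩ := one_lt_card.1 (show 1 < #(L v) by rw [hk]; omega)
    obtain ⟨x, hx, rfl⟩ := hφ.exists_adj_color hT ha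
    obtain ⟨y, hy, rfl⟩ := hφ.exists_adj_color hT hb
    obtain ⟨n, p, hC, rfl, hA⟩ := hv.exists_cycle hφ hx hy hab
    rcases hC.three_le.lt_or_eq with hn | rfl
    · obtain ⟨h1, h2, h3⟩ := hA.isBidirectedOddCycle hC hT hn hv hk
      exact ⟨Or.inr (Or.inl ⟨h1, h2⟩), h3⟩
    · obtain ⟨ψ, hψ, hne⟩ := hA
      obtain ⟨h1, h2, h3⟩ := ColorfulClique.isBidirectedComplete (K := univ.image p) hT
        ⟨mem_image_of_mem _ (mem_univ _), fun a ha b hb hab => by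
          obtain ⟨i, -, rfl⟩ := mem_image.1 ha
          obtain ⟨j, -, rfl⟩ := mem_image.1 hb
          rw [hC.adj_iff]
          have : ∀ i j : ZMod 3, i ≠ j → j = i + 1 ∨ i = j + 1 := by decide
          exact this i j fun e => hab (congrArg p e),
        ψ, hψ, p 1, mem_image_of_mem _ (mem_univ _), p (-1), mem_image_of_mem _ (mem_univ _),
        hC.inj.ne (by decide), hC.inj.ne (by decide), hne⟩ hv hk
      exact ⟨Or.inl ⟨h1, h2⟩, h3⟩

end

end Digraph

theorem mainTheorem5 {V α : Type*} [Fintype V] (D : Digraph V)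
    (hloopless : ∀ v, ¬ D.Adj v v) (hconn : D.IsConnected)
    (s : ℕ) (hs : 1 ≤ s) (L : V → Finset α)
    (hL : ∀ v, (D.maxDeg : ℚ) / (s : ℚ) ≤ ((L v).card : ℚ)) :
    ¬ D.IsListColorable L s ↔
      ((D.IsBidirectedComplete ∧ Fintype.card V - 1 ≡ 0 [MOD s]) ∨
        (D.IsBidirectedOddCycle ∧ s = 1) ∨
        (D.IsEulerian ∧ ∀ v, D.inDeg v = s ∧ D.outDeg v = s)) ∧
      ∃ Γ : Finset α, (∀ v, L v = Γ) ∧ (Γ.card : ℚ) = (D.maxDeg : ℚ) / (s : ℚ) := by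
  have hne : Nonempty V := SimpleGraph.Connected.nonempty hconn
  have hs0 : (0 : ℚ) < s := by exact_mod_cast hs
  have hL' : ∀ v, D.maxDeg ≤ s * (L v).card := fun v => by
    have := (div_le_iff₀' hs0).1 (hL v)
    exact_mod_cast this
  constructor
  · intro hcol
    have hT : D.Tight L s :=
      { loopless := hloopless
        connected := hconn
        pos := hs
        out_le := fun v => by
          rw [← D.outDeg_eq_card]; exact (D.outDeg_le_maxDeg v).trans (hL' v)
        in_le := fun v => by
          rw [← D.inDeg_eq_card]; exact (D.inDeg_le_maxDeg v).trans (hL' v)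
        not_colorable := fun φ hφ => hcol hφ.isListColorable }
    rcases subsingleton_or_nontrivial V with hV | hV
    -- A single vertex has maximum degree zero and hence must have an empty list; it counts as a
    -- complete digraph with `Γ = ∅`.
    · have hcard : Fintype.card V = 1 :=
        le_antisymm (Fintype.card_le_one_iff_subsingleton.2 hV) Fintype.card_pos
      have hadj : ∀ u w, ¬ D.Adj u w := fun u w h =>
        hloopless u (by rwa [Subsingleton.elim w u] at h)
      have hmax : D.maxDeg = 0 := Digraph.maxDeg_eq_of_regular fun v => by
        simp [Digraph.outDeg, Digraph.inDeg, hadj]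
      refine ⟨Or.inl ⟨?_, by rw [hcard]⟩, ∅, hT.list_eq_empty, by simp [hmax]⟩
      refine Digraph.ext ?_
      funext u w
      exact propext ⟨fun h => absurd h (hadj u w), fun h => absurd (Subsingleton.elim u w) (SimpleGraph.Adj.ne (G := ⊤) h)⟩
    · have hdeg : ∀ v, s * (L v).card = D.maxDeg := fun v => by
        obtain ⟨φ, hφ⟩ := hT.exists_conf hT.list_nonempty v
        refine le_antisymm ?_ (hL' v)
        rw [← (hφ.out_spec hT).1, ← D.outDeg_eq_card]
        exact D.outDeg_le_maxDeg v
      obtain ⟨v⟩ := hne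
      have hk : ∀ w, (L w).card = (L v).card := fun w =>
        Nat.eq_of_mul_eq_mul_left hs ((hdeg w).trans (hdeg v).symm)
      obtain ⟨h1, h2⟩ := hT.structure hk (hT.list_nonempty v).card_pos
      refine ⟨h1, L v, fun w => hT.list_eq_of_subset hk h2 v w, ?_⟩
      rw [eq_div_iff hs0.ne', ← hdeg v]
      push_cast; ring
  · rintro ⟨h, Γ, hΓ, hcard⟩
    have hcard' : s * Γ.card = D.maxDeg := by
      rw [eq_div_iff hs0.ne', mul_comm] at hcard
      exact_mod_cast hcard
    rcases h with ⟨h, -⟩ | ⟨h, rfl⟩ | ⟨-, h⟩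
    · exact Digraph.not_isListColorable_of_complete h hΓ hcard'
    · exact Digraph.not_isListColorable_of_oddCycle h hΓ (by rwa [one_mul] at hcard')
    · refine Digraph.not_isListColorable_of_regular h hΓ ?_
      rw [Digraph.maxDeg_eq_of_regular fun v => ⟨(h v).2, (h v).1⟩] at hcard'
      nlinarith
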